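/- Let $\widehat{A}$ be a topological group isomorphic to $\widehat{\mathbb{Z}}^2$ (written multiplicatively), topologically generated by $a_1,a_2$, and let $\widehat{\mathbb{Z}}[[\widehat{A}]]=\varprojlim\,(\widehat{\mathbb{Z}}/I)[\widehat{A}/U]$ ($I$, $U$ running over the open ideals of $\widehat{\mathbb Z}$ and the open normal subgroups of $\widehat A$) be its completed group algebra, with the inverse limit topology of discrete rings. For a prime $p$ let $\mathrm{Cyc}_p$ be the set of monic irreducible factors in $\mathbb{Z}_p[x]$ of the polynomials $x^m-1$ with $m\ge 1$ prime to $p$. For $r\ge 1$ let $\mathbb{Z}_{p^r}$ be the ring of integers of the unramified extension of $\mathbb{Q}_p$ of degree $r$. Finite free $\mathbb{Z}_p$-modules carry the $p$-adic topology, power series rings the topology of coefficientwise convergence, and products the product topology. (1) There is an isomorphism of topological rings $$\Phi:\widehat{\mathbb{Z}}[[\widehat{A}]]\;\cong\;\prod_{p}\ \prod_{(f_1,f_2)\in \mathrm{Cyc}_p^2}\Big(\mathbb{Z}_p[x_1]/(f_1)\otimes_{\mathbb{Z}_p}\mathbb{Z}_p[x_2]/(f_2)\Big)[[s_1,s_2]]$$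 under which $a_i$ has the image $x_i(1+s_i)$ in each factor, $i=1,2$. (2) Each ring $\mathbb{Z}_p[x_1]/(f_1)\otimes_{\mathbb{Z}_p}\mathbb{Z}_p[x_2]/(f_2)$ is isomorphic, as a $\mathbb{Z}_p$-algebra, to a finite product of rings $\mathbb{Z}_{p^r}$ with $r\ge 1$, and these isomorphisms can be chosen so that the resulting refinement of $\Phi$ is an isomorphism of topological rings from $\widehat{\mathbb{Z}}[[\widehat{A}]]$ to a product of rings $\mathbb{Z}_{p^r}[[s_1,s_2]]$ (the "coordinates"), each of which is a complete regular local ring. In each coordinate $\mathbb{Z}_{p^r}[[s_1,s_2]]$ the image of $a_i$ is $u_i(1+s_i)$, where $u_1,u_2\in\mathbb{Z}_{p^r}$ are roots of unity of order prime to $p$ and $\mathbb{Z}_{p^r}=\mathbb{Z}_p[u_1,u_2]$. (3) In each coordinate the images of $a_1-1$ and $a_2-1$ are nonzero, and no prime element of $\mathbb{Z}_{p^r}[[s_1,s_2]]$ divides both. For every prime $p$ there is exactly one coordinate $\mathbb{Z}_{p^r}[[s_1,s_2]]$ over $p$ in which the images of $a_1-1$ and $a_2-1$ are both prime; in it these images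 are $s_1$ and $s_2$. In every other coordinate at least one of the two images is a unit. -/

import Mathlib

open Polynomial TensorProduct
open scoped MvPowerSeries.WithPiTopology

noncomputable section

instance instFactPrimesPrime (p : Nat.Primes) : Fact (p : ℕ).Prime := ⟨p.2⟩

/-! ### The ring of profinite integers -/

/-- The compatible families in `∏ n, ℤ/n`. -/
def zHatSubring : Subring (∀ n : ℕ+, ZMod n) where
  carrier := {x | ∀ (m n : ℕ+) (h : (m : ℕ) ∣ n), ZMod.castHom h (ZMod m) (x n) = x m}
  zero_mem' := fun m n h => by simp only [Pi.zero_apply, map_zero]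
  one_mem' := fun m n h => by simp only [Pi.one_apply, map_one]
  add_mem' := fun {x y} hx hy m n h => by simp only [Pi.add_apply, map_add, hx m n h, hy m n h]
  mul_mem' := fun {x y} hx hy m n h => by simp only [Pi.mul_apply, map_mul, hx m n h, hy m n h]
  neg_mem' := fun {x} hx m n h => by simp only [Pi.neg_apply, map_neg, hx m n h]

/-- The profinite integers `lim ℤ/n`, with the inverse limit topology (each `ℤ/n` is discrete). -/
abbrev ZHat : Type := zHatSubring

/-! ### Completed group algebras -/

section CompletedGroupAlgebra

variable (R : Type*) [CommRing R] [TopologicalSpace R] (G : Type*) [Group G] [TopologicalSpace G]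

/-- Pairs consisting of an open ideal of `R` and an open normal subgroup of `G`. -/
abbrev CGAIndex : Type _ := {I : Ideal R // IsOpen (I : Set R)} × OpenNormalSubgroup G

variable {R G} in
/-- The group ring `(R/I)[G/U]`. -/
abbrev CGALevel (i : CGAIndex R G) : Type _ :=
  MonoidAlgebra (R ⧸ i.1.1) (G ⧸ i.2.toSubgroup)

variable {R G} in
/-- The natural projection `(R/I)[G/U] → (R/J)[G/V]` for `I ≤ J` and `U ≤ V`. -/
def cgaTransition (i j : CGAIndex R G) (hI : i.1.1 ≤ j.1.1)
    (hU : i.2.toSubgroup ≤ j.2.toSubgroup) : CGALevel i →+* CGALevel j :=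
  (MonoidAlgebra.mapRingHom (G ⧸ j.2.toSubgroup) (Ideal.Quotient.factor hI)).comp
    (MonoidAlgebra.mapDomainRingHom (R ⧸ i.1.1)
      (QuotientGroup.map i.2.toSubgroup j.2.toSubgroup (MonoidHom.id G)
        (hU.trans (Subgroup.comap_id _).ge)))

/-- The compatible families in `∏ (R/I)[G/U]`. -/
def completedGroupAlgebraSubring : Subring (∀ i : CGAIndex R G, CGALevel i) where
  carrier := {x | ∀ (i j : CGAIndex R G) (hI : i.1.1 ≤ j.1.1)
    (hU : i.2.toSubgroup ≤ j.2.toSubgroup), cgaTransition i j hI hU (x i) = x j}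
  zero_mem' := fun i j hI hU => by simp only [Pi.zero_apply, map_zero]
  one_mem' := fun i j hI hU => by simp only [Pi.one_apply, map_one]
  add_mem' := fun {x y} hx hy i j hI hU => by
    simp only [Pi.add_apply, map_add, hx i j hI hU, hy i j hI hU]
  mul_mem' := fun {x y} hx hy i j hI hU => by
    simp only [Pi.mul_apply, map_mul, hx i j hI hU, hy i j hI hU]
  neg_mem' := fun {x} hx i j hI hU => by simp only [Pi.neg_apply, map_neg, hx i j hI hU]

/-- The completed group algebra `R⟦G⟧ = lim (R/I)[G/U]`, over all open ideals `I` of `R` and open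
normal subgroups `U` of `G`. -/
def CompletedGroupAlgebra : Type _ := completedGroupAlgebraSubring R G

namespace CompletedGroupAlgebra

instance : Ring (CompletedGroupAlgebra R G) :=
  inferInstanceAs (Ring (completedGroupAlgebraSubring R G))

/-- The inverse limit topology, each `(R/I)[G/U]` being discrete. -/
instance : TopologicalSpace (CompletedGroupAlgebra R G) :=
  TopologicalSpace.induced
    (fun x : completedGroupAlgebraSubring R G => (x : ∀ i : CGAIndex R G, CGALevel i))
    (@Pi.topologicalSpace (CGAIndex R G) (fun i => CGALevel i) (fun _ => ⊥))

variable {G} in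
/-- The canonical map `G → R⟦G⟧`. -/
def of : G →* CompletedGroupAlgebra R G where
  toFun g := ⟨fun i => MonoidAlgebra.of (R ⧸ i.1.1) (G ⧸ i.2.toSubgroup) (QuotientGroup.mk g),
    fun i j hI hU => by
      simp only [cgaTransition, MonoidAlgebra.of_apply, RingHom.comp_apply,
        MonoidAlgebra.mapDomainRingHom_apply, MonoidAlgebra.mapDomain_single,
        MonoidAlgebra.mapRingHom_single, map_one]
      rfl⟩
  map_one' := Subtype.ext (funext fun i =>
    map_one (MonoidAlgebra.of (R ⧸ i.1.1) (G ⧸ i.2.toSubgroup)))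
  map_mul' g h := Subtype.ext (funext fun i =>
    map_mul (MonoidAlgebra.of (R ⧸ i.1.1) (G ⧸ i.2.toSubgroup)) (g : G ⧸ i.2.toSubgroup) h)

end CompletedGroupAlgebra

end CompletedGroupAlgebra

/-! ### The coefficient rings -/

section Coefficients

variable (p : ℕ) [Fact p.Prime]

/-- The monic irreducible factors over `ℤ_p` of the polynomials `x ^ m - 1` with `m ≥ 1` prime
to `p`. -/
def Cyc : Set ℤ_[p][X] :=
  {f | f.Monic ∧ Irreducible f ∧ ∃ m : ℕ, 1 ≤ m ∧ m.Coprime p ∧ f ∣ X ^ m - 1}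

variable {p} in
/-- The ring `ℤ_p[x₁]/(f₁) ⊗ ℤ_p[x₂]/(f₂)`, the tensor product being over `ℤ_p`. -/
def CycTensor (f : Cyc p × Cyc p) : Type :=
  AdjoinRoot (f.1 : ℤ_[p][X]) ⊗[ℤ_[p]] AdjoinRoot (f.2 : ℤ_[p][X])

namespace CycTensor

variable {p} (f : Cyc p × Cyc p)

instance : CommRing (CycTensor f) :=
  inferInstanceAs (CommRing (AdjoinRoot (f.1 : ℤ_[p][X]) ⊗[ℤ_[p]] AdjoinRoot (f.2 : ℤ_[p][X])))

instance : Algebra ℤ_[p] (CycTensor f) :=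
  inferInstanceAs
    (Algebra ℤ_[p] (AdjoinRoot (f.1 : ℤ_[p][X]) ⊗[ℤ_[p]] AdjoinRoot (f.2 : ℤ_[p][X])))

/-- The `p`-adic topology of this finite free `ℤ_p`-module. -/
instance : TopologicalSpace (CycTensor f) := moduleTopology ℤ_[p] (CycTensor f)

/-- The classes of `x₁` (index `0`) and `x₂` (index `1`). -/
def root : Fin 2 → CycTensor f :=
  ![(AdjoinRoot.root (f.1 : ℤ_[p][X]) ⊗ₜ[ℤ_[p]] (1 : AdjoinRoot (f.2 : ℤ_[p][X])) :),
    ((1 : AdjoinRoot (f.1 : ℤ_[p][X])) ⊗ₜ[ℤ_[p]] AdjoinRoot.root (f.2 : ℤ_[p][X]) :)]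

end CycTensor

/-- For `r ≥ 1` and `q = p ^ r`, the ring `ℤ_q` of integers of the unramified extension
`ℚ_q = ℚ_p(ζ_{q-1})` of `ℚ_p` of degree `r`. -/
def Zq (r : ℕ) : Type := integralClosure ℤ_[p] (CyclotomicField (p ^ r - 1) ℚ_[p])

namespace Zq

variable (r : ℕ)

instance : CommRing (Zq p r) :=
  inferInstanceAs (CommRing (integralClosure ℤ_[p] (CyclotomicField (p ^ r - 1) ℚ_[p])))

instance : Algebra ℤ_[p] (Zq p r) :=
  inferInstanceAs (Algebra ℤ_[p] (integralClosure ℤ_[p] (CyclotomicField (p ^ r - 1) ℚ_[p])))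

/-- The `p`-adic topology of this finite free `ℤ_p`-module. -/
instance : TopologicalSpace (Zq p r) := moduleTopology ℤ_[p] (Zq p r)

end Zq

end Coefficients

end

/-!
The completed group algebra `L = ℤ̂⟦A⟧` and the product `R` of the power series rings over the
coefficient rings `ℤ_p[x₁]/(f₁) ⊗ ℤ_p[x₂]/(f₂)` are compact Hausdorff rings, and both are
completions of the polynomial ring `ℤ[x₁, x₂]`, the variables being sent to `a₁, a₂` in `L` and to
the elements `x_i (1 + s_i)` in `R`. Two such completions are isomorphic as soon as they induce
the same topology on the polynomial ring (`exists_ringEquiv_of_denseRange`), so four facts are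
needed.

* The image in `L` is dense (`CompletedGroupAlgebra.denseRange_polyMap`), because `a₁, a₂`
  generate the finite quotients of `A`.
* The image in `R` is dense (`CycProduct.denseRange_polyMap`). Its closure contains the
  idempotents of all factors: those of the parts over the various `p` are limits of powers of
  integers, and within such a part those of the factors come from the limits of powers of values
  of elements of `Cyc p`. In a single factor, `x_i` is the limit of powers of `x_i (1 + s_i)`.
* The map from `ℤ[x₁, x₂]` to a finite quotient ring of `R` factors through a group ring of a
  finite quotient of `A` over some `ℤ/n`, as the images of `x_i (1 + s_i)` are units of finite
  order and `A` is free profinite abelian on `a₁, a₂`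
  (`CompletedGroupAlgebra.tendsto_comap_polyMap`).
* Evaluation of polynomials at two elements of finite order of a finite ring `F` is continuous for
  the topology induced by `R` (`CycProduct.eventually_aeval_eq_zero`). When `p` is nilpotent in
  `F`, the elements are `t_i w_i` with `t_i` of order `m` prime to `p` and `w_i` unipotent; by the
  Chinese remainder theorem for the factorization of `x ^ m - 1` each `t_i` may be assumed to be a
  root of an element `f_i` of `Cyc p`, and then power series over the ring belonging to `(f₁, f₂)`
  can be evaluated in `F`.

The coefficient rings are unramified: finite and torsion-free over `ℤ_p`, with a power of the
Frobenius map trivial modulo `p` (`IsPadicUnramified`). Such a ring is split by its idempotents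
into rings whose elements are units or divisible by `p`, by means of Teichmüller representatives
(`IsPadicUnramified.local_of_idempotent`). A ring of the latter kind is a discrete valuation ring
generated over `ℤ_p` by a primitive root of unity of order `p ^ r - 1`, the Teichmüller lift of a
generator of the multiplicative group of its residue field, and is therefore isomorphic to the
ring of integers of `ℚ_p(ζ_{p ^ r - 1})` (`IsPadicUnramifiedLocal.exists_algEquiv_zq`).

In a coordinate, `a_i - 1` has the image `u_i (1 + s_i) - 1` with constant term `u_i - 1`. As
`u_i` is a root of unity of order prime to `p`, either this image is a unit or `u_i = 1` and the
image is `s_i` (`IsPadicUnramifiedLocal.eq_one_of_pow_eq_one`). Both `u_i` are `1` only if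
`f₁ = f₂ = x - 1`, where the coefficient ring is `ℤ_p` itself.
-/

open Filter Topology

/-! ### Finite algebras over the `p`-adic integers -/

section FiniteAlgebras

variable (p : ℕ) [Fact p.Prime] (B : Type*) [CommRing B] [Algebra ℤ_[p] B]
  [Module.Finite ℤ_[p] B] [TopologicalSpace B] [IsModuleTopology ℤ_[p] B]

include p

theorem PadicInt.finite_moduleTopology_isTopologicalRing : IsTopologicalRing B :=
  IsModuleTopology.isTopologicalRing ℤ_[p] B

theorem PadicInt.finite_moduleTopology_compactSpace : CompactSpace B := by
  obtain ⟨n, f, hf⟩ := Module.Finite.exists_fin' ℤ_[p] B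
  have := PadicInt.finite_moduleTopology_isTopologicalRing p B
  have hc : Continuous f := IsModuleTopology.continuous_of_linearMap f
  exact ⟨by rw [← hf.range_eq]; exact isCompact_range hc⟩

theorem PadicInt.finite_moduleTopology_t2Space [Module.Free ℤ_[p] B] : T2Space B := by
  let b := Module.Free.chooseBasis ℤ_[p] B
  have := PadicInt.finite_moduleTopology_isTopologicalRing p B
  have hc : Continuous b.equivFun := IsModuleTopology.continuous_of_linearMap b.equivFun.toLinearMap
  exact T2Space.of_injective_continuous b.equivFun.injective hc

theorem PadicInt.isOpen_range_pow_mul (k : ℕ) :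
    IsOpen (Set.range fun b : B => (p : B) ^ k * b) := by
  obtain ⟨n, f, hf⟩ := Module.Finite.exists_fin' ℤ_[p] B
  have := PadicInt.finite_moduleTopology_isTopologicalRing p B
  have ho : IsOpenMap f := IsModuleTopology.isOpenMap_of_surjective hf
  -- the open ball of radius `p ^ (-k + 1)` is `p ^ k ℤ_p`
  let D : Set ℤ_[p] := Metric.ball 0 ((p : ℝ) ^ (-k + 1 : ℤ))
  have hs : IsOpen {v : Fin n → ℤ_[p] | ∀ i, v i ∈ D} := by
    have : {v : Fin n → ℤ_[p] | ∀ i, v i ∈ D} = Set.pi Set.univ fun _ => D := by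
      ext; simp
    rw [this]
    exact isOpen_set_pi Set.finite_univ fun _ _ => Metric.isOpen_ball
  convert ho _ hs using 1
  ext b
  simp only [Set.mem_range, Set.mem_image, Set.mem_ofPred_eq, D, mem_ball_zero_iff]
  have key : ∀ x : ℤ_[p], ‖x‖ < (p : ℝ) ^ (-k + 1 : ℤ) ↔ (p : ℤ_[p]) ^ k ∣ x := fun x => by
    rw [← PadicInt.norm_le_pow_iff_norm_lt_pow_add_one, PadicInt.norm_le_pow_iff_mem_span_pow,
      Ideal.mem_span_singleton]
  simp only [key]
  constructor
  · rintro ⟨c, rfl⟩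
    obtain ⟨v, rfl⟩ := hf c
    refine ⟨(p : ℤ_[p]) ^ k • v, fun i => ⟨v i, rfl⟩, ?_⟩
    rw [map_smul, Algebra.smul_def]; simp
  · rintro ⟨v, hv, rfl⟩
    choose w hw using hv
    refine ⟨f w, ?_⟩
    have : v = (p : ℤ_[p]) ^ k • w := funext hw
    rw [this, map_smul, Algebra.smul_def]; simp

/-- By compactness of `B`, multiplication by a high power of `p` maps all of `B` into a given
neighbourhood of zero. -/
theorem PadicInt.exists_pow_mul_subset {U : Set B} (hU : U ∈ 𝓝 (0 : B)) :
    ∃ k : ℕ, (Set.range fun b : B => (p : B) ^ k * b) ⊆ U := by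
  have := PadicInt.finite_moduleTopology_isTopologicalRing p B
  have := PadicInt.finite_moduleTopology_compactSpace p B
  obtain ⟨V, hV, hVo, h0⟩ := mem_nhds_iff.1 hU
  have hc : Continuous fun x : ℤ_[p] × B => x.1 • x.2 := continuous_smul
  obtain ⟨u, v, hu, -, hu0, hv, huv⟩ := generalized_tube_lemma (s := {(0 : ℤ_[p])})
    isCompact_singleton (t := (Set.univ : Set B)) isCompact_univ (hVo.preimage hc)
    (by rintro ⟨a, b⟩ ⟨rfl, -⟩; simpa using h0)
  have ht : Tendsto (fun k : ℕ => (p : ℤ_[p]) ^ k) atTop (𝓝 0) :=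
    tendsto_pow_atTop_nhds_zero_of_norm_lt_one (by
      rw [PadicInt.norm_p]
      exact inv_lt_one_of_one_lt₀ (by exact_mod_cast (Fact.out : p.Prime).one_lt))
  obtain ⟨k, hk⟩ := (ht.eventually_mem (hu.mem_nhds (hu0 rfl))).exists
  refine ⟨k, ?_⟩
  rintro _ ⟨b, rfl⟩
  have : ((p : ℤ_[p]) ^ k, b) ∈ u ×ˢ v := ⟨hk, hv trivial⟩
  have := huv this
  simp only [Set.mem_preimage, Algebra.smul_def] at this
  apply hV
  simpa using this

theorem PadicInt.finite_moduleTopology_isLinearTopology : IsLinearTopology B B := by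
  have := PadicInt.finite_moduleTopology_isTopologicalRing p B
  refine IsLinearTopology.mk_of_hasBasis' B (ι := ℕ) (p := fun _ => True)
    (s := fun k => Ideal.span {(p : B) ^ k}) ?_ fun s r m hm => s.smul_mem r hm
  have hr : ∀ k : ℕ, ((Ideal.span {(p : B) ^ k} : Ideal B) : Set B) =
      Set.range fun b : B => (p : B) ^ k * b := fun k => by
    ext b
    simp [Ideal.mem_span_singleton, dvd_def, eq_comm]
  refine ⟨fun U => ⟨fun hU => ?_, ?_⟩⟩
  · obtain ⟨k, hk⟩ := PadicInt.exists_pow_mul_subset p B hU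
    exact ⟨k, trivial, by rw [hr]; exact hk⟩
  · rintro ⟨k, -, hk⟩
    refine mem_of_superset (IsOpen.mem_nhds ?_ (Ideal.zero_mem _)) hk
    rw [hr]; exact PadicInt.isOpen_range_pow_mul p B k

theorem PadicInt.isTopologicallyNilpotent_natCast : IsTopologicallyNilpotent (p : B) := by
  have := PadicInt.finite_moduleTopology_isTopologicalRing p B
  have ht : Tendsto (fun k : ℕ => (p : ℤ_[p]) ^ k) atTop (𝓝 0) :=
    tendsto_pow_atTop_nhds_zero_of_norm_lt_one (by
      rw [PadicInt.norm_p]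
      exact inv_lt_one_of_one_lt₀ (by exact_mod_cast (Fact.out : p.Prime).one_lt))
  have hc : Continuous (algebraMap ℤ_[p] B) := continuous_algebraMap ℤ_[p] B
  have := (hc.tendsto 0).comp ht
  simpa [IsTopologicallyNilpotent, Function.comp_def] using this

end FiniteAlgebras

/-! ### Closed subrings of compact rings -/

section CompactRings

variable {R : Type*} [CommRing R] [TopologicalSpace R] [IsTopologicalRing R]

theorem Ideal.finite_quotient_of_isOpen [CompactSpace R] {J : Ideal R} (hJ : IsOpen (J : Set R)) :
    Finite (R ⧸ J) :=
  AddSubgroup.quotient_finite_of_isOpen J.toAddSubgroup hJ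

theorem IsLinearTopology.mem_closure_of_forall_ideal [IsLinearTopology R R] {C : Set R} {x : R}
    (h : ∀ J : Ideal R, IsOpen (J : Set R) → ∃ y ∈ C, y - x ∈ J) : x ∈ closure C := by
  rw [mem_closure_iff_nhds]
  intro U hU
  have : (fun y => y + x) ⁻¹' U ∈ 𝓝 (0 : R) :=
    (continuous_add_const x).continuousAt.preimage_mem_nhds (by simpa using hU)
  obtain ⟨J, hJ, hJU⟩ := IsLinearTopology.hasBasis_open_ideal.mem_iff.1 this
  obtain ⟨y, hy, hyx⟩ := h J hJ
  exact ⟨y, by simpa using hJU hyx, hy⟩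

theorem IsIdempotentElem.mul_add_one_sub_mul_pow {R : Type*} [CommRing R] {e : R}
    (he : IsIdempotentElem e) (a b : R)
    (n : ℕ) : (e * a + (1 - e) * b) ^ n = e * a ^ n + (1 - e) * b ^ n := by
  induction n with
  | zero => simp
  | succ n ih =>
    rw [pow_succ, ih]
    have h : e * e = e := he
    linear_combination (a ^ n * a + b ^ n * b - b ^ n * a - a ^ n * b) * h

/-- A closed subring containing an element that is a unit on the part cut out by the idempotent `e`
and topologically nilpotent on the complementary part contains `e`: suitable powers of the element
tend to `e`. -/
theorem Subring.mem_of_unit_add_topologicallyNilpotent [CompactSpace R] [IsLinearTopology R R]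
    {C : Subring R} (hC : IsClosed (C : Set R)) {e u z : R} (he : IsIdempotentElem e)
    (hu : IsUnit u) (hz : IsTopologicallyNilpotent z) (hv : e * u + (1 - e) * z ∈ C) : e ∈ C := by
  have : e ∈ _root_.closure (C : Set R) := by
    refine IsLinearTopology.mem_closure_of_forall_ideal fun J hJ => ?_
    have := Ideal.finite_quotient_of_isOpen hJ
    obtain ⟨K, hK⟩ := (hz.eventually_mem (hJ.mem_nhds J.zero_mem)).exists_forall_of_atTop
    let N := Nat.card (R ⧸ J)ˣ
    have hN : 1 ≤ N := Nat.card_pos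
    refine ⟨_, C.pow_mem hv (N * K), ?_⟩
    rw [he.mul_add_one_sub_mul_pow]
    have h1 : z ^ (N * K) ∈ J := hK _ (Nat.le_mul_of_pos_left K hN)
    have h2 : u ^ (N * K) - 1 ∈ J := by
      rw [← Ideal.Quotient.eq_zero_iff_mem, map_sub, map_pow, map_one, pow_mul]
      obtain ⟨w, hw⟩ := hu.map (Ideal.Quotient.mk J)
      rw [← hw, ← Units.val_pow_eq_pow_val, pow_card_eq_one']
      simp
    have : e * u ^ (N * K) + (1 - e) * z ^ (N * K) - e =
        e * (u ^ (N * K) - 1) + (1 - e) * z ^ (N * K) := by ring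
    rw [this]
    exact J.add_mem (J.mul_mem_left _ h2) (J.mul_mem_left _ h1)
  rwa [hC.closure_eq] at this

/-- The element `(1 + s) ^ p ^ b - 1` is divisible by `p` as soon as `s ^ b = 0`, and every further
`p`-th power gains a factor `p`. -/
theorem exists_one_add_pow_prime_pow_eq_one {R : Type*} [CommRing R] {p : ℕ} {s : R}
    (hp : IsNilpotent (p : R)) (hs : IsNilpotent s) [hpp : Fact p.Prime] :
    ∃ K, ∀ k ≥ K, (1 + s) ^ p ^ k = 1 := by
  obtain ⟨a, ha⟩ := hp
  obtain ⟨b, hb⟩ := hs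
  refine ⟨b + a, fun k hk => ?_⟩
  obtain ⟨c, rfl⟩ := Nat.exists_eq_add_of_le hk
  have h1 : (p : R) ∣ (1 + s) ^ p ^ b - 1 := by
    obtain ⟨r, hr⟩ := exists_add_pow_prime_pow_eq hpp.out (1 : R) s b
    have hs0 : s ^ p ^ b = 0 := by
      obtain ⟨d, hd⟩ := Nat.exists_eq_add_of_le (Nat.lt_pow_self (n := b) hpp.out.one_lt).le
      rw [hd, pow_add, hb, zero_mul]
    refine ⟨s * r, ?_⟩
    rw [hr, hs0]
    ring
  have h2 := dvd_sub_pow_of_dvd_sub h1 (a + c)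
  rw [one_pow, ← pow_mul, ← pow_add, ← add_assoc, add_assoc a c 1, pow_add, ha, zero_mul,
    zero_dvd_iff, sub_eq_zero] at h2
  exact h2

/-- A closed subring containing the product of a root of unity `x` of order prime to `p` and a
principal unit `w` contains `x`: the powers of `x * w` with exponents `p ^ (φ(m) K)` tend to `x`. -/
theorem Subring.mem_of_mul_principalUnit_mem [CompactSpace R] [IsLinearTopology R R] {p : ℕ}
    [hpp : Fact p.Prime] {C : Subring R} (hC : IsClosed (C : Set R)) {x w : R} {m : ℕ}
    (hm : m.Coprime p) (hx : x ^ m = 1) (hp : IsTopologicallyNilpotent (p : R))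
    (hw : IsTopologicallyNilpotent (w - 1)) (h : x * w ∈ C) : x ∈ C := by
  have : x ∈ _root_.closure (C : Set R) := by
    refine IsLinearTopology.mem_closure_of_forall_ideal fun J hJ => ?_
    have hn : ∀ z : R, IsTopologicallyNilpotent z → IsNilpotent (Ideal.Quotient.mk J z) :=
      fun z hz => by
        obtain ⟨n, hn⟩ := (hz.eventually_mem (hJ.mem_nhds J.zero_mem)).exists
        exact ⟨n, by rw [← map_pow]; exact Ideal.Quotient.eq_zero_iff_mem.2 hn⟩
    obtain ⟨K, hK⟩ := exists_one_add_pow_prime_pow_eq_one (p := p)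
      (by simpa using hn _ hp) (hn _ hw)
    have hm0 : 0 < m.totient * K ∨ K = 0 := by
      rcases Nat.eq_zero_or_pos K with h | h
      · exact Or.inr h
      · refine Or.inl (Nat.mul_pos (Nat.totient_pos.2 (Nat.pos_of_ne_zero ?_)) h)
        rintro rfl
        exact hpp.out.one_lt.ne' (by simpa using hm)
    have hmK : K ≤ m.totient * K := by
      rcases hm0 with h | h
      · exact Nat.le_mul_of_pos_left K (Nat.pos_of_mul_pos_right h)
      · simp [h]
    refine ⟨_, C.pow_mem h (p ^ (m.totient * K)), ?_⟩
    rw [← Ideal.Quotient.eq_zero_iff_mem, mul_pow, map_sub, map_mul]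
    have h1 := hK _ hmK
    rw [map_sub, map_one, add_sub_cancel] at h1
    have h2 : x ^ p ^ (m.totient * K) = x := by
      have : p ^ (m.totient * K) ≡ 1 [MOD m] := by
        rw [pow_mul]
        simpa using (Nat.ModEq.pow_totient hm.symm).pow K
      conv_rhs => rw [← pow_one x]
      exact pow_eq_pow_of_modEq this hx
    rw [h2, map_pow, h1, mul_one, sub_self]
  rwa [hC.closure_eq] at this

end CompactRings

/-! ### Closed subrings of products -/

section Products

variable {ι : Type*} {R : ι → Type*} [∀ i, CommRing (R i)]

/-- Every element of a product is the limit of the finite sums of its components. -/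
theorem Subring.eq_top_of_single_mem [∀ i, TopologicalSpace (R i)] [DecidableEq ι]
    {C : Subring (∀ i, R i)} (hC : IsClosed (C : Set (∀ i, R i)))
    (h : ∀ i r, Pi.single i r ∈ C) : C = ⊤ := by
  refine eq_top_iff.2 fun x _ => ?_
  have ht : Tendsto (fun s : Finset ι => ∑ i ∈ s, Pi.single i (x i)) atTop (𝓝 x) := by
    rw [tendsto_pi_nhds]
    intro i
    refine tendsto_const_nhds.congr' ?_
    filter_upwards [eventually_ge_atTop {i}] with s hs
    rw [Finset.sum_apply, Finset.sum_pi_single, if_pos (Finset.singleton_subset_iff.1 hs)]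
  exact hC.mem_of_tendsto ht (Eventually.of_forall fun s => C.sum_mem fun i _ => h i _)

/-- The trace on the `i`-th factor of a subring of a product that contains the `i`-th idempotent. -/
def Subring.piTrace [DecidableEq ι] (C : Subring (∀ i, R i)) (i : ι) (hi : Pi.single i 1 ∈ C) :
    Subring (R i) where
  carrier := {r | Pi.single i r ∈ C}
  zero_mem' := by simp
  one_mem' := hi
  add_mem' ha hb := by
    simp only [Set.mem_ofPred_eq, Pi.single_add] at *
    exact C.add_mem ha hb
  mul_mem' ha hb := by
    simp only [Set.mem_ofPred_eq, Pi.single_mul] at *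
    exact C.mul_mem ha hb
  neg_mem' ha := by
    simp only [Set.mem_ofPred_eq, Pi.single_neg] at *
    exact C.neg_mem ha

theorem Subring.isClosed_piTrace [∀ i, TopologicalSpace (R i)] [DecidableEq ι]
    {C : Subring (∀ i, R i)} (hC : IsClosed (C : Set (∀ i, R i))) (i : ι) (hi : Pi.single i 1 ∈ C) :
    IsClosed (C.piTrace i hi : Set (R i)) :=
  hC.preimage (continuous_single i)

theorem Subring.apply_mem_piTrace [DecidableEq ι] {C : Subring (∀ i, R i)} (i : ι)
    (hi : Pi.single i 1 ∈ C) {x : ∀ i, R i} (hx : x ∈ C) : x i ∈ C.piTrace i hi := by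
  have h : Pi.single i (x i) = Pi.single i 1 * x := by
    rw [← Pi.single_mul_left, one_mul]
  change Pi.single i (x i) ∈ C
  rw [h]
  exact C.mul_mem hi hx

instance Pi.isLinearTopology [∀ i, TopologicalSpace (R i)]
    [∀ i, IsLinearTopology (R i) (R i)] :
    IsLinearTopology (∀ i, R i) (∀ i, R i) := by
  classical
  refine IsLinearTopology.mk_of_hasBasis' (∀ i, R i)
    (ι := Set ι × (∀ i, Ideal (R i)))
    (p := fun s => s.1.Finite ∧ ∀ i ∈ s.1, (s.2 i : Set (R i)) ∈ 𝓝 0)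
    (s := fun s => ⨅ i ∈ s.1, (s.2 i).comap (Pi.evalRingHom R i)) ?_ fun s r m hm => s.smul_mem r hm
  have h := hasBasis_pi (f := fun i => 𝓝 (0 : R i))
    fun i => IsLinearTopology.hasBasis_ideal (R := R i)
  rw [← nhds_pi] at h
  convert h using 1
  · rfl
  · ext s x
    simp [Set.mem_pi]

end Products

/-! ### Comparison of two completions of a ring -/

section TwoCompletions

variable {S L R : Type*} [Ring L] [TopologicalSpace L] [Ring R] [TopologicalSpace R]

/-- If `ψ` is small wherever `φ` is, the closure of the set of pairs `(φ g, ψ g)` meets `{0} × R`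
only in zero. -/
theorem eq_zero_of_mem_closure_range_prod [T2Space R] {φ : S → L} {ψ : S → R}
    (h : Tendsto ψ (comap φ (𝓝 0)) (𝓝 0)) {r : R}
    (hr : ((0 : L), r) ∈ closure (Set.range fun g => (φ g, ψ g))) : r = 0 := by
  have hne : (comap (fun g => (φ g, ψ g)) (𝓝 ((0 : L), r))).NeBot := by
    rw [comap_neBot_iff]
    intro t ht
    obtain ⟨_, hx, g, rfl⟩ := mem_closure_iff_nhds.1 hr t ht
    exact ⟨g, hx⟩
  have ht : Tendsto (fun g => (φ g, ψ g)) (comap (fun g => (φ g, ψ g)) (𝓝 ((0 : L), r)))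
    (𝓝 (0, r)) := tendsto_comap
  have h1 := (continuous_fst.tendsto _).comp ht
  have h2 := (continuous_snd.tendsto _).comp ht
  exact tendsto_nhds_unique h2 (h.comp (tendsto_comap_iff.2 h1))

/-- Two compact Hausdorff rings that contain dense images of one ring, inducing the same topology
on it, are isomorphic: the closure of the image of that ring in the product is the graph of an
isomorphism. -/
theorem exists_ringEquiv_of_denseRange [Ring S] [IsTopologicalRing L] [IsTopologicalRing R]
    [CompactSpace L] [CompactSpace R] [T2Space L] [T2Space R] (φ : S →+* L) (ψ : S →+* R)
    (hφ : DenseRange φ) (hψ : DenseRange ψ) (h₁ : Tendsto φ (comap ψ (𝓝 0)) (𝓝 0))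
    (h₂ : Tendsto ψ (comap φ (𝓝 0)) (𝓝 0)) :
    ∃ Φ : L ≃+* R, IsHomeomorph Φ ∧ ∀ g, Φ (φ g) = ψ g := by
  let T : Subring (L × R) := (φ.prod ψ).range.topologicalClosure
  have hTc : IsClosed (T : Set (L × R)) := Subring.isClosed_topologicalClosure _
  have hT : (T : Set (L × R)) = closure (Set.range fun g => (φ g, ψ g)) := rfl
  have : CompactSpace T := isCompact_iff_compactSpace.1 hTc.isCompact
  have hmem : ∀ g, (φ g, ψ g) ∈ T := fun g => by
    change _ ∈ (T : Set (L × R))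
    rw [hT]
    exact subset_closure ⟨g, rfl⟩
  let f₁ : T →+* L := (RingHom.fst L R).comp T.subtype
  let f₂ : T →+* R := (RingHom.snd L R).comp T.subtype
  have c₁ : Continuous f₁ := continuous_fst.comp continuous_subtype_val
  have c₂ : Continuous f₂ := continuous_snd.comp continuous_subtype_val
  have s₁ : Function.Surjective f₁ := by
    refine Set.range_eq_univ.1 ?_
    rw [← (isCompact_range c₁).isClosed.closure_eq]
    exact (hφ.mono (by rintro _ ⟨g, rfl⟩; exact ⟨⟨_, hmem g⟩, rfl⟩)).closure_eq
  have s₂ : Function.Surjective f₂ := by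
    refine Set.range_eq_univ.1 ?_
    rw [← (isCompact_range c₂).isClosed.closure_eq]
    exact (hψ.mono (by rintro _ ⟨g, rfl⟩; exact ⟨⟨_, hmem g⟩, rfl⟩)).closure_eq
  have i₁ : Function.Injective f₁ := by
    refine (injective_iff_map_eq_zero f₁).2 ?_
    rintro ⟨⟨l, r⟩, hx⟩ (rfl : l = 0)
    have := eq_zero_of_mem_closure_range_prod h₂ (hT.subset hx)
    subst this
    rfl
  have i₂ : Function.Injective f₂ := by
    refine (injective_iff_map_eq_zero f₂).2 ?_
    rintro ⟨⟨l, r⟩, hx⟩ (rfl : r = 0)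
    have hx' : ((0 : R), l) ∈ closure (Set.range fun g => (ψ g, φ g)) := by
      have : (l, (0 : R)) ∈ closure (Set.range fun g => (φ g, ψ g)) := hT.subset hx
      have h := map_mem_closure continuous_swap this (t := Set.range fun g => (ψ g, φ g))
        (by rintro _ ⟨g, rfl⟩; exact ⟨g, rfl⟩)
      exact h
    have := eq_zero_of_mem_closure_range_prod h₁ hx'
    subst this
    rfl
  let e₁ := RingEquiv.ofBijective f₁ ⟨i₁, s₁⟩
  let e₂ := RingEquiv.ofBijective f₂ ⟨i₂, s₂⟩
  have H₁ : IsHomeomorph e₁ := isHomeomorph_iff_continuous_bijective.2 ⟨c₁, i₁, s₁⟩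
  have H₂ : IsHomeomorph e₂ := isHomeomorph_iff_continuous_bijective.2 ⟨c₂, i₂, s₂⟩
  refine ⟨e₁.symm.trans e₂, ?_, fun g => ?_⟩
  · refine H₂.comp (g := e₂) (f := e₁.symm) ?_
    exact (H₁.homeomorph.symm).isHomeomorph
  · have : e₁.symm (φ g) = ⟨_, hmem g⟩ := by
      rw [RingEquiv.symm_apply_eq]; rfl
    rw [RingEquiv.trans_apply, this]
    rfl

end TwoCompletions

/-! ### Open ideals of the profinite integers -/

section ProfiniteIntegers

instance ZHat.compactSpace : CompactSpace ZHat := by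
  have hc : IsClosed (zHatSubring : Set (∀ n : ℕ+, ZMod n)) := by
    have : (zHatSubring : Set (∀ n : ℕ+, ZMod n)) =
        ⋂ (m : ℕ+) (n : ℕ+) (h : (m : ℕ) ∣ n), {x | ZMod.castHom h (ZMod m) (x n) = x m} := by
      ext x
      simp only [Set.mem_iInter]
      rfl
    rw [this]
    refine isClosed_iInter fun m => isClosed_iInter fun n => isClosed_iInter fun h => ?_
    exact isClosed_eq (continuous_of_discreteTopology.comp (continuous_apply n))
      (continuous_apply m)
  have : ∀ n : ℕ+, Finite (ZMod n) := fun n => inferInstance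
  exact isCompact_iff_compactSpace.1 hc.isCompact

/-- The projection of the profinite integers to `ℤ/n`. -/
noncomputable def ZHat.toZMod (n : ℕ+) : ZHat →+* ZMod n :=
  (Pi.evalRingHom _ n).comp zHatSubring.subtype

theorem ZHat.continuous_toZMod (n : ℕ+) : Continuous (ZHat.toZMod n) :=
  (continuous_apply n).comp continuous_subtype_val

theorem ZHat.toZMod_surjective (n : ℕ+) : Function.Surjective (ZHat.toZMod n) := fun z => by
  obtain ⟨k, rfl⟩ := ZMod.intCast_surjective z
  exact ⟨k, map_intCast _ k⟩

theorem ZHat.isOpen_ker_toZMod (n : ℕ+) : IsOpen (RingHom.ker (ZHat.toZMod n) : Set ZHat) :=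
  (isOpen_discrete ({0} : Set (ZMod n))).preimage (ZHat.continuous_toZMod n)

theorem ZHat.exists_ker_toZMod_le {I : Ideal ZHat} (hI : IsOpen (I : Set ZHat)) :
    ∃ n : ℕ+, RingHom.ker (ZHat.toZMod n) ≤ I := by
  obtain ⟨U, hU, hUI⟩ := isOpen_induced_iff.1 hI
  have h0 : (0 : ∀ n : ℕ+, ZMod n) ∈ U := by
    have : (0 : ZHat) ∈ Subtype.val ⁻¹' U := by rw [hUI]; exact I.zero_mem
    exact this
  obtain ⟨s, u, hu, hsu⟩ := isOpen_pi_iff.1 hU 0 h0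
  refine ⟨∏ n ∈ s, n, fun z hz => ?_⟩
  have : z ∈ Subtype.val ⁻¹' U := by
    refine hsu fun n hn => ?_
    have hd : (n : ℕ) ∣ ((∏ n ∈ s, n : ℕ+) : ℕ) := PNat.dvd_iff.1 (Finset.dvd_prod_of_mem _ hn)
    have h1 := z.2 n _ hd
    have h2 : z.1 (∏ n ∈ s, n) = 0 := hz
    rw [h2, map_zero] at h1
    have := (hu n hn).2
    rw [← h1]
    exact this
  rw [hUI] at this
  exact this

theorem ZHat.exists_int_sub_mem {I : Ideal ZHat} (hI : IsOpen (I : Set ZHat)) (z : ZHat) :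
    ∃ k : ℤ, z - k ∈ I := by
  obtain ⟨n, hn⟩ := ZHat.exists_ker_toZMod_le hI
  obtain ⟨k, hk⟩ := ZMod.intCast_surjective (ZHat.toZMod n z)
  exact ⟨k, hn (by rw [RingHom.mem_ker, map_sub, map_intCast, hk, sub_self])⟩

end ProfiniteIntegers

/-! ### The topology of completed group algebras -/

namespace CompletedGroupAlgebra

section Topology

variable (R : Type*) [CommRing R] [TopologicalSpace R] (G : Type*) [Group G] [TopologicalSpace G]

variable {R G} in
/-- The projection of the completed group algebra to `(R/I)[G/U]`. -/
noncomputable def proj (i : CGAIndex R G) : CompletedGroupAlgebra R G →+* CGALevel i :=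
  (Pi.evalRingHom _ i).comp (completedGroupAlgebraSubring R G).subtype

variable {R G}

theorem ext_proj {x y : CompletedGroupAlgebra R G} (h : ∀ i, proj i x = proj i y) : x = y :=
  Subtype.ext (funext h)

theorem cgaTransition_proj {i j : CGAIndex R G} (hI : i.1.1 ≤ j.1.1)
    (hU : i.2.toSubgroup ≤ j.2.toSubgroup) (x : CompletedGroupAlgebra R G) :
    cgaTransition i j hI hU (proj i x) = proj j x := x.2 i j hI hU

theorem proj_of (i : CGAIndex R G) (g : G) :
    proj i (of R g) = MonoidAlgebra.of (R ⧸ i.1.1) (G ⧸ i.2.toSubgroup) (QuotientGroup.mk g) := rfl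

theorem tendsto_iff {ι : Type*} {l : Filter ι} {f : ι → CompletedGroupAlgebra R G}
    {x : CompletedGroupAlgebra R G} :
    Tendsto f l (𝓝 x) ↔ ∀ i, ∀ᶠ k in l, proj i (f k) = proj i x := by
  let : ∀ i : CGAIndex R G, TopologicalSpace (CGALevel i) := fun _ => ⊥
  have : ∀ i : CGAIndex R G, DiscreteTopology (CGALevel i) := fun _ => ⟨rfl⟩
  let F : CompletedGroupAlgebra R G → ∀ i, CGALevel i := fun x i => proj i x
  have : 𝓝 x = comap F (𝓝 (F x)) := nhds_induced F x
  rw [this, tendsto_comap_iff, tendsto_pi_nhds]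
  refine forall_congr' fun i => ?_
  rw [nhds_discrete, tendsto_pure]
  rfl

instance : IsTopologicalRing (CompletedGroupAlgebra R G) := by
  let : ∀ i : CGAIndex R G, TopologicalSpace (CGALevel i) := fun _ => ⊥
  have : ∀ i : CGAIndex R G, DiscreteTopology (CGALevel i) := fun _ => ⟨rfl⟩
  exact inferInstanceAs (IsTopologicalRing (completedGroupAlgebraSubring R G))

instance : T2Space (CompletedGroupAlgebra R G) := by
  let : ∀ i : CGAIndex R G, TopologicalSpace (CGALevel i) := fun _ => ⊥
  have : ∀ i : CGAIndex R G, DiscreteTopology (CGALevel i) := fun _ => ⟨rfl⟩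
  exact inferInstanceAs (T2Space (completedGroupAlgebraSubring R G))

theorem finite_level [CompactSpace R] [IsTopologicalRing R] [CompactSpace G] [IsTopologicalGroup G]
    (i : CGAIndex R G) : Finite (CGALevel i) := by
  have : Finite (R ⧸ i.1.1) := Ideal.finite_quotient_of_isOpen i.1.2
  have : Finite (G ⧸ i.2.toSubgroup) :=
    Subgroup.quotient_finite_of_isOpen i.2.toSubgroup i.2.isOpen'
  exact Finite.of_injective (fun x : CGALevel i => (x.coeff : _ → _))
    (fun x y h => by
      cases x; cases y
      simpa using h)

theorem compactSpace [CompactSpace R] [IsTopologicalRing R] [CompactSpace G]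
    [IsTopologicalGroup G] : CompactSpace (CompletedGroupAlgebra R G) := by
  let : ∀ i : CGAIndex R G, TopologicalSpace (CGALevel i) := fun _ => ⊥
  have : ∀ i : CGAIndex R G, DiscreteTopology (CGALevel i) := fun _ => ⟨rfl⟩
  have : ∀ i : CGAIndex R G, Finite (CGALevel i) := finite_level
  have : IsClosed (completedGroupAlgebraSubring R G : Set (∀ i : CGAIndex R G, CGALevel i)) := by
    have : (completedGroupAlgebraSubring R G : Set (∀ i : CGAIndex R G, CGALevel i)) =
        ⋂ (i : CGAIndex R G) (j : CGAIndex R G) (hI : i.1.1 ≤ j.1.1)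
          (hU : i.2.toSubgroup ≤ j.2.toSubgroup), {x | cgaTransition i j hI hU (x i) = x j} := by
      ext x
      simp only [Set.mem_iInter]
      rfl
    rw [this]
    refine isClosed_iInter fun i => isClosed_iInter fun j => isClosed_iInter fun hI =>
      isClosed_iInter fun hU => ?_
    exact isClosed_eq (continuous_of_discreteTopology.comp (continuous_apply i))
      (continuous_apply j)
  exact isCompact_iff_compactSpace.1 this.isCompact

/-- Finitely many levels are dominated by one. -/
theorem exists_le_finset (s : Finset (CGAIndex R G)) :
    ∃ i : CGAIndex R G, ∀ j ∈ s, i.1.1 ≤ j.1.1 ∧ i.2.toSubgroup ≤ j.2.toSubgroup := by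
  classical
  induction s using Finset.induction_on with
  | empty =>
    exact ⟨⟨⟨⊤, isOpen_univ⟩,
      { toOpenSubgroup := ⊤, isNormal' := inferInstanceAs (⊤ : Subgroup G).Normal }⟩, by simp⟩
  | insert j s _ ih =>
    obtain ⟨i, hi⟩ := ih
    refine ⟨⟨⟨i.1.1 ⊓ j.1.1, i.1.2.inter j.1.2⟩, i.2 ⊓ j.2⟩, fun k hk => ?_⟩
    rcases Finset.mem_insert.1 hk with rfl | hk
    · exact ⟨inf_le_right, inf_le_right⟩
    · exact ⟨inf_le_left.trans (hi k hk).1, inf_le_left.trans (hi k hk).2⟩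

theorem denseRange_of_surjective_proj {S : Type*}
    (φ : S → CompletedGroupAlgebra R G) (h : ∀ i x, ∃ g, proj i (φ g) = x) : DenseRange φ := by
  let : ∀ i : CGAIndex R G, TopologicalSpace (CGALevel i) := fun _ => ⊥
  have : ∀ i : CGAIndex R G, DiscreteTopology (CGALevel i) := fun _ => ⟨rfl⟩
  intro x
  rw [mem_closure_iff]
  intro U hU hx
  obtain ⟨V, hV, rfl⟩ := isOpen_induced_iff.1 hU
  obtain ⟨s, u, hu, hsu⟩ := isOpen_pi_iff.1 hV x.1 hx
  obtain ⟨i, hi⟩ := exists_le_finset s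
  obtain ⟨g, hg⟩ := h i (proj i x)
  refine ⟨φ g, hsu fun j hj => ?_, g, rfl⟩
  have : proj j (φ g) = proj j x := by
    rw [← cgaTransition_proj (hi j hj).1 (hi j hj).2, hg, cgaTransition_proj]
  change proj j (φ g) ∈ u j
  rw [this]
  exact (hu j hj).2

end Topology

section Commutative

variable {R : Type*} [CommRing R] [TopologicalSpace R] {A : Type*} [CommGroup A]
  [TopologicalSpace A]

theorem level_mul_comm (i : CGAIndex R A) (x y : CGALevel i) : x * y = y * x :=
  mul_comm x y

/-- The ring structure of the completed group algebra of a commutative group. The instance is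
scoped, so that elsewhere operations on completed group algebras refer to the given ring
structure. -/
noncomputable scoped instance : CommRing (CompletedGroupAlgebra R A) where
  mul_comm x y := ext_proj fun i => by
    rw [map_mul, map_mul, level_mul_comm]

end Commutative

end CompletedGroupAlgebra

/-! ### Homomorphisms from the group -/

section FreeProfiniteAbelian

variable {A : Type*} [CommGroup A] [TopologicalSpace A] [IsTopologicalGroup A]

/-- Two topological generators of `ℤ̂²` can be sent to any two elements of finite order of an
abelian group by a homomorphism with open kernel: modulo `M` they form a basis of `(ℤ/M)²`, being
two generators of this finite group. -/
theorem exists_monoidHom_isOpen_ker (hA : Nonempty (A ≃ₜ* Multiplicative (ZHat × ZHat)))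
    {a : Fin 2 → A} (ha : (Subgroup.closure (Set.range a)).topologicalClosure = ⊤)
    {Y : Type*} [CommGroup Y] (y : Fin 2 → Y) (M : ℕ+) (hy : ∀ j, y j ^ (M : ℕ) = 1) :
    ∃ χ : A →* Y, IsOpen (χ.ker : Set A) ∧ ∀ j, χ (a j) = y j := by
  obtain ⟨e⟩ := hA
  let W := ZMod M × ZMod M
  let q : ZHat × ZHat →+ W :=
    (ZHat.toZMod M).toAddMonoidHom.prodMap (ZHat.toZMod M).toAddMonoidHom
  have hq : Function.Surjective q :=
    Function.Surjective.prodMap (ZHat.toZMod_surjective M) (ZHat.toZMod_surjective M)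
  have hqc : Continuous q := (ZHat.continuous_toZMod M).prodMap (ZHat.continuous_toZMod M)
  let π : A →* Multiplicative W := q.toMultiplicative.comp e.toMonoidHom
  have hπ : Function.Surjective π := fun w => by
    obtain ⟨z, hz⟩ := hq w.toAdd
    refine ⟨e.symm (Multiplicative.ofAdd z), ?_⟩
    change Multiplicative.ofAdd (q (e (e.symm (Multiplicative.ofAdd z))).toAdd) = w
    rw [ContinuousMulEquiv.apply_symm_apply, toAdd_ofAdd, hz, ofAdd_toAdd]
  have hπc : Continuous fun x => (π x).toAdd :=
    hqc.comp (continuous_toAdd.comp e.continuous_toFun)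
  let b : Fin 2 → W := fun j => (π (a j)).toAdd
  let θ : W →ₗ[ZMod M] W :=
    (LinearMap.toSpanSingleton (ZMod M) W (b 0)).coprod (LinearMap.toSpanSingleton (ZMod M) W (b 1))
  have hθ0 : θ (1, 0) = b 0 := by
    change (1 : ZMod M) • b 0 + (0 : ZMod M) • b 1 = b 0
    rw [one_smul, zero_smul, add_zero]
  have hθ1 : θ (0, 1) = b 1 := by
    change (0 : ZMod M) • b 0 + (1 : ZMod M) • b 1 = b 1
    rw [one_smul, zero_smul, zero_add]
  have hθ : Function.Surjective θ := by
    let K : Subgroup A := (AddSubgroup.toSubgroup θ.toAddMonoidHom.range).comap π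
    have hK : IsClosed (K : Set A) :=
      (isClosed_discrete (θ.toAddMonoidHom.range : Set W)).preimage hπc
    have hKt : K = ⊤ := by
      refine top_le_iff.1 (ha ▸ Subgroup.topologicalClosure_minimal _ ?_ hK)
      rw [Subgroup.closure_le]
      rintro _ ⟨j, rfl⟩
      fin_cases j
      · exact ⟨(1, 0), hθ0⟩
      · exact ⟨(0, 1), hθ1⟩
    intro w
    obtain ⟨x, hx⟩ := hπ (Multiplicative.ofAdd w)
    have : x ∈ K := hKt ▸ Subgroup.mem_top x
    obtain ⟨v, hv⟩ := this
    refine ⟨v, hv.trans ?_⟩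
    change (π x).toAdd = w
    rw [hx, toAdd_ofAdd]
  have hθb : Function.Bijective θ := ⟨Finite.injective_iff_surjective.2 hθ, hθ⟩
  let θe : W ≃+ W := AddEquiv.ofBijective θ.toAddMonoidHom hθb
  let l : Fin 2 → ZMod M →+ Additive Y := fun j =>
    ZMod.lift M ⟨zmultiplesHom (Additive Y) (Additive.ofMul (y j)), by
      rw [zmultiplesHom_apply, natCast_zsmul, ← ofMul_pow, hy, ofMul_one]⟩
  have hl : ∀ j, l j 1 = Additive.ofMul (y j) := fun j => by
    have := ZMod.lift_coe M ⟨zmultiplesHom (Additive Y) (Additive.ofMul (y j)), by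
      rw [zmultiplesHom_apply, natCast_zsmul, ← ofMul_pow, hy, ofMul_one]⟩ 1
    simpa [l] using this
  let τ : W →+ Additive Y := (l 0).coprod (l 1)
  have h0 : θe.symm (b 0) = (1, 0) := by rw [AddEquiv.symm_apply_eq]; exact hθ0.symm
  have h1 : θe.symm (b 1) = (0, 1) := by rw [AddEquiv.symm_apply_eq]; exact hθ1.symm
  let σ : W →+ Additive Y := τ.comp θe.symm.toAddMonoidHom
  let χ : A →* Y := (AddMonoidHom.toMultiplicativeLeft σ).comp π
  have hχ : ∀ x, χ x = (σ (π x).toAdd).toMul := fun x => rfl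
  refine ⟨χ, ?_, fun j => ?_⟩
  · exact (isOpen_discrete {w : W | (σ w).toMul = 1}).preimage hπc
  · rw [hχ]
    fin_cases j
    · change (τ (θe.symm (b 0))).toMul = _
      rw [h0]
      change (l 0 1 + l 1 0).toMul = y 0
      rw [hl, map_zero, add_zero, toMul_ofMul]
    · change (τ (θe.symm (b 1))).toMul = _
      rw [h1]
      change (l 0 0 + l 1 1).toMul = y 1
      rw [hl, map_zero, zero_add, toMul_ofMul]

/-- Two elements of finite order of a ring of positive characteristic are the images of the
topological generators under a homomorphism from one of the group rings `(ℤ̂/I)[A/U]`. -/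
theorem exists_level_ringHom (hA : Nonempty (A ≃ₜ* Multiplicative (ZHat × ZHat)))
    {a : Fin 2 → A} (ha : (Subgroup.closure (Set.range a)).topologicalClosure = ⊤)
    {Q : Type*} [CommRing Q] (y : Fin 2 → Q) (M n : ℕ+) (hy : ∀ j, y j ^ (M : ℕ) = 1)
    (hn : ((n : ℕ) : Q) = 0) :
    ∃ (i : CGAIndex ZHat A) (h : CGALevel i →+* Q),
      ∀ j, h (CompletedGroupAlgebra.proj i (CompletedGroupAlgebra.of ZHat (a j))) = y j := by
  let u : Fin 2 → Qˣ := fun j => Units.ofPowEqOne (y j) M (hy j) M.ne_zero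
  obtain ⟨χ, hχ, hχa⟩ := exists_monoidHom_isOpen_ker hA ha u M fun j => by
    ext; simp [u]
  let i : CGAIndex ZHat A := ⟨⟨_, ZHat.isOpen_ker_toZMod n⟩,
    { toSubgroup := χ.ker, isOpen' := hχ, isNormal' := inferInstance }⟩
  let f : (ZHat ⧸ i.1.1) →+* Q :=
    (ZMod.castHom (ringChar.dvd hn) Q).comp (RingHom.kerLift (ZHat.toZMod n))
  let g : A ⧸ i.2.toSubgroup →* Q := (Units.coeHom Q).comp (QuotientGroup.kerLift χ)
  refine ⟨i, MonoidAlgebra.liftNCRingHom f g fun x y => Commute.all _ _, fun j => ?_⟩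
  rw [CompletedGroupAlgebra.proj_of, MonoidAlgebra.of_apply]
  change MonoidAlgebra.liftNC f.toAddMonoidHom g _ = _
  rw [MonoidAlgebra.liftNC_single]
  have : g (QuotientGroup.mk (a j)) = y j := by
    change ((χ (a j) : Qˣ) : Q) = y j
    rw [hχa]
    rfl
  rw [this]
  simp

end FreeProfiniteAbelian

/-! ### The polynomial ring in the completed group algebra -/

namespace CompletedGroupAlgebra

variable {A : Type*} [CommGroup A] [TopologicalSpace A]

/-- The homomorphism `ℤ[x₁, x₂] → ℤ̂⟦A⟧` sending the variables to given group elements. -/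
noncomputable def polyMap (a : Fin 2 → A) :
    MvPolynomial (Fin 2) ℤ →+* CompletedGroupAlgebra ZHat A :=
  (MvPolynomial.aeval fun j => of ZHat (a j)).toRingHom

theorem polyMap_X (a : Fin 2 → A) (j : Fin 2) : polyMap a (MvPolynomial.X j) = of ZHat (a j) :=
  MvPolynomial.aeval_X _ j

theorem proj_polyMap (a : Fin 2 → A) (i : CGAIndex ZHat A) (g : MvPolynomial (Fin 2) ℤ) :
    proj i (polyMap a g) = MvPolynomial.aeval (fun j => proj i (of ZHat (a j))) g := by
  have h : (proj i).comp (polyMap a) =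
      (MvPolynomial.aeval (R := ℤ) fun j => proj i (of ZHat (a j))).toRingHom := by
    refine MvPolynomial.ringHom_ext (fun n => ?_) fun j => ?_
    · simp
    · rw [RingHom.comp_apply, polyMap_X]
      exact (MvPolynomial.aeval_X (R := ℤ) (fun j => proj i (of ZHat (a j))) j).symm
  exact RingHom.congr_fun h g

/-- A homomorphism from `ℤ[x₁, x₂]` to a compact ring with linear topology sending the variables to
units is continuous for the topology induced by the completed group algebra: its composite with
the projection to a finite quotient factors through a group ring `(ℤ̂/I)[A/U]`. -/
theorem tendsto_comap_polyMap [IsTopologicalGroup A]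
    (hA : Nonempty (A ≃ₜ* Multiplicative (ZHat × ZHat)))
    {a : Fin 2 → A} (ha : (Subgroup.closure (Set.range a)).topologicalClosure = ⊤)
    {R : Type*} [CommRing R] [TopologicalSpace R] [IsTopologicalRing R] [CompactSpace R]
    [IsLinearTopology R R] (ψ : MvPolynomial (Fin 2) ℤ →+* R)
    (hψ : ∀ j, IsUnit (ψ (MvPolynomial.X j))) :
    Tendsto ψ (comap (polyMap a) (𝓝 0)) (𝓝 0) := by
  rw [IsLinearTopology.hasBasis_open_ideal.tendsto_right_iff]
  intro J hJ
  have := Ideal.finite_quotient_of_isOpen hJ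
  have : Finite (R ⧸ J)ˣ := inferInstance
  let M : ℕ+ := ⟨Nat.card (R ⧸ J)ˣ, Nat.card_pos⟩
  let n : ℕ+ := ⟨Nat.card (R ⧸ J), Nat.card_pos⟩
  obtain ⟨i, h, hh⟩ := exists_level_ringHom hA ha
    (fun j => Ideal.Quotient.mk J (ψ (MvPolynomial.X j))) M n
    (fun j => by
      obtain ⟨w, hw⟩ := (hψ j).map (Ideal.Quotient.mk J)
      rw [← hw, ← Units.val_pow_eq_pow_val, PNat.mk_coe, pow_card_eq_one', Units.val_one])
    (by
      have := card_nsmul_eq_zero' (x := (1 : R ⧸ J))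
      rwa [nsmul_one] at this)
  have key : ∀ g, h (proj i (polyMap a g)) = Ideal.Quotient.mk J (ψ g) := by
    intro g
    have : (h.comp (proj i)).comp (polyMap a) =
        (Ideal.Quotient.mk J).comp ψ := by
      refine MvPolynomial.ringHom_ext (fun n => by simp) fun j => ?_
      simp only [RingHom.comp_apply, polyMap_X, hh]
    exact RingHom.congr_fun this g
  have hev : ∀ᶠ g in comap (polyMap a) (𝓝 0), proj i (polyMap a g) = proj i 0 :=
    tendsto_iff.1 tendsto_comap i
  filter_upwards [hev] with g hg
  rw [SetLike.mem_coe, ← Ideal.Quotient.eq_zero_iff_mem, ← key, hg, map_zero, map_zero]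

theorem compactSpace_of_equiv (hA : Nonempty (A ≃ₜ* Multiplicative (ZHat × ZHat))) :
    CompactSpace A := by
  obtain ⟨e⟩ := hA
  have : CompactSpace (Multiplicative (ZHat × ZHat)) :=
    inferInstanceAs (CompactSpace (ZHat × ZHat))
  exact e.toHomeomorph.symm.compactSpace

theorem exists_pow_proj_of_eq_one [IsTopologicalGroup A] [CompactSpace A] (i : CGAIndex ZHat A) :
    ∃ M n : ℕ+, ((n : ℕ) : CGALevel i) = 0 ∧ ∀ g : A, proj i (of ZHat g) ^ (M : ℕ) = 1 := by
  have := finite_level i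
  have : Finite (A ⧸ i.2.toSubgroup) :=
    Subgroup.quotient_finite_of_isOpen i.2.toSubgroup i.2.isOpen'
  refine ⟨⟨Nat.card (A ⧸ i.2.toSubgroup), Nat.card_pos⟩, ⟨Nat.card (CGALevel i), Nat.card_pos⟩,
    ?_, fun g => ?_⟩
  · have := card_nsmul_eq_zero' (x := (1 : CGALevel i))
    rwa [nsmul_one] at this
  · rw [proj_of, PNat.mk_coe, ← map_pow, pow_card_eq_one', map_one]

/-- The image of `ℤ[x₁, x₂]` in the finite ring `(ℤ̂/I)[A/U]` is everything: it contains the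
inverses of the generators, which are powers of them, and `ℤ` is dense in `ℤ̂`. -/
theorem denseRange_polyMap [IsTopologicalGroup A] [CompactSpace A]
    {a : Fin 2 → A} (ha : (Subgroup.closure (Set.range a)).topologicalClosure = ⊤) :
    DenseRange (polyMap a) := by
  refine denseRange_of_surjective_proj _ fun i => ?_
  obtain ⟨M, n, -, hM⟩ := exists_pow_proj_of_eq_one i
  let T : Subring (CGALevel i) := ((proj i).comp (polyMap a)).range
  have hT : ∀ g ∈ Subgroup.closure (Set.range a), proj i (of ZHat g) ∈ T := by
    intro g hg
    induction hg using Subgroup.closure_induction with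
    | mem x hx =>
      obtain ⟨j, rfl⟩ := hx
      exact ⟨MvPolynomial.X j, by rw [RingHom.comp_apply, polyMap_X]⟩
    | one => rw [map_one, map_one]; exact T.one_mem
    | mul x y _ _ hx hy => rw [map_mul, map_mul]; exact T.mul_mem hx hy
    | inv x _ hx =>
      have h1 : proj i (of ZHat x⁻¹) = proj i (of ZHat x) ^ ((M : ℕ) - 1) := by
        have h2 : proj i (of ZHat x⁻¹) * proj i (of ZHat x) = 1 := by
          rw [← map_mul, ← map_mul, inv_mul_cancel, map_one, map_one]
        calc proj i (of ZHat x⁻¹) = proj i (of ZHat x⁻¹) * proj i (of ZHat x) ^ (M : ℕ) := by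
              rw [hM, mul_one]
          _ = proj i (of ZHat x⁻¹) * proj i (of ZHat x) * proj i (of ZHat x) ^ ((M : ℕ) - 1) := by
              rw [mul_assoc, mul_pow_sub_one M.ne_zero]
          _ = _ := by rw [h2, one_mul]
      rw [h1]
      exact T.pow_mem hx _
  have hT' : ∀ g : A, proj i (of ZHat g) ∈ T := by
    intro g
    have hg : g ∈ closure (Subgroup.closure (Set.range a) : Set A) := by
      have : g ∈ (Subgroup.closure (Set.range a)).topologicalClosure := ha ▸ Subgroup.mem_top g
      exact this
    have hU : (fun x => g⁻¹ * x) ⁻¹' (i.2.toSubgroup : Set A) ∈ 𝓝 g :=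
      (i.2.isOpen'.preimage (continuous_const_mul g⁻¹)).mem_nhds (by
        simp)
    obtain ⟨x, hx, hxc⟩ := mem_closure_iff_nhds.1 hg _ hU
    have : (QuotientGroup.mk g : A ⧸ i.2.toSubgroup) = QuotientGroup.mk x :=
      QuotientGroup.eq.2 hx
    rw [proj_of, this, ← proj_of]
    exact hT x hxc
  have hsingle : ∀ (g : A ⧸ i.2.toSubgroup) (r : ZHat ⧸ i.1.1), MonoidAlgebra.single g r ∈ T := by
    intro g r
    obtain ⟨g, rfl⟩ := QuotientGroup.mk_surjective g
    obtain ⟨z, rfl⟩ := Ideal.Quotient.mk_surjective r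
    obtain ⟨k, hk⟩ := ZHat.exists_int_sub_mem i.1.2 z
    have h1 : Ideal.Quotient.mk i.1.1 z = (k : ZHat ⧸ i.1.1) := by
      rw [← map_intCast (Ideal.Quotient.mk i.1.1)]
      exact Ideal.Quotient.eq.2 hk
    have h2 : (MonoidAlgebra.single (QuotientGroup.mk g) (Ideal.Quotient.mk i.1.1 z) : CGALevel i) =
        k • proj i (of ZHat g) := by
      rw [h1, proj_of, MonoidAlgebra.of_apply, MonoidAlgebra.smul_single, zsmul_one]
    rw [h2]
    exact T.zsmul_mem (hT' g) k
  intro x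
  have : x ∈ T := by
    induction x using MonoidAlgebra.induction_linear with
    | zero => exact T.zero_mem
    | add x y hx hy => exact T.add_mem hx hy
    | single g r => exact hsingle g r
  exact this

end CompletedGroupAlgebra

/-! ### Factors of `x ^ m - 1` over the `p`-adic integers -/

section Coprimality

/-- The polynomial `x ^ m - 1` is separable when `m` is a unit, since `x · (x ^ m - 1)' - m (x ^ m
- 1)` is the unit `m`; so complementary factors are coprime. -/
theorem Polynomial.isCoprime_of_mul_dvd_X_pow_sub_one {R : Type*} [CommRing R] {m : ℕ}
    (hm : IsUnit (m : R)) (hm0 : m ≠ 0) {f g : R[X]} (h : f * g ∣ X ^ m - 1) : IsCoprime f g := by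
  obtain ⟨q, hq⟩ := h
  obtain ⟨c, hc⟩ := hm.exists_left_inv
  have hd : (m : R[X]) * X ^ (m - 1) = derivative (f * g * q) := by
    rw [← hq]; simp [derivative_X_pow]
  have hX : (X : R[X]) * X ^ (m - 1) = X ^ m := mul_pow_sub_one hm0 X
  have hc' : C c * (m : R[X]) = 1 := by
    rw [← C_eq_natCast, ← C_mul, hc, C_1]
  simp only [derivative_mul] at hd
  refine ⟨C c * X * (g * derivative q + derivative g * q) - g * q, C c * X * derivative f * q, ?_⟩
  linear_combination -C c * X * hd + C c * (m : R[X]) * hX + X ^ m * hc' + hq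

variable {p : ℕ} [Fact p.Prime]

theorem PadicInt.isUnit_natCast_of_coprime {m : ℕ} (hm : m.Coprime p) : IsUnit (m : ℤ_[p]) := by
  rw [PadicInt.isUnit_iff]
  refine le_antisymm (PadicInt.norm_le_one _) (not_lt.1 fun h => ?_)
  have : (m : ℤ_[p]) = ((m : ℤ) : ℤ_[p]) := by simp
  rw [this, PadicInt.norm_int_lt_one_iff_dvd, Int.natCast_dvd_natCast] at h
  exact (Fact.out : p.Prime).one_lt.ne' (Nat.dvd_one.1 (hm ▸ Nat.dvd_gcd h dvd_rfl))

theorem Cyc.isCoprime {f g : ℤ_[p][X]} (hf : f ∈ Cyc p) (hg : g ∈ Cyc p) (hne : f ≠ g) :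
    IsCoprime f g := by
  obtain ⟨hfm, hfi, m, hm1, hm, hfd⟩ := hf
  obtain ⟨hgm, hgi, n, hn1, hn, hgd⟩ := hg
  refine isCoprime_of_mul_dvd_X_pow_sub_one (m := m * n)
    (PadicInt.isUnit_natCast_of_coprime (hm.mul_left hn)) (by positivity) ?_
  have hrel : IsRelPrime f g := by
    refine (hfi.isRelPrime_iff_not_dvd).2 fun hd => hne ?_
    exact eq_of_monic_of_associated hfm hgm (hfi.associated_of_dvd hgi hd)
  refine hrel.mul_dvd (hfd.trans ?_) (hgd.trans ?_)
  · simpa [pow_mul] using sub_dvd_pow_sub_pow ((X : ℤ_[p][X]) ^ m) 1 n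
  · rw [mul_comm]
    simpa [pow_mul] using sub_dvd_pow_sub_pow ((X : ℤ_[p][X]) ^ n) 1 m

/-- For `m` prime to `p`, the polynomial `x ^ m - 1` is a product of distinct elements of `Cyc p`.
-/
theorem Cyc.exists_prod_eq {m : ℕ} (hm1 : 1 ≤ m) (hm : m.Coprime p) :
    ∃ S : Finset (Cyc p), ∏ f ∈ S, (f : ℤ_[p][X]) = X ^ m - 1 := by
  classical
  suffices H : ∀ (d : ℕ) (g : ℤ_[p][X]), g.natDegree = d → g.Monic → g ∣ X ^ m - 1 →
      ∃ S : Finset (Cyc p), ∏ f ∈ S, (f : ℤ_[p][X]) = g from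
    H _ _ rfl (by simpa using monic_X_pow_sub_C (1 : ℤ_[p]) (by omega)) dvd_rfl
  intro d
  induction d using Nat.strong_induction_on with
  | _ d ih =>
    intro g hgd hgm hg
    by_cases hu : IsUnit g
    · exact ⟨∅, by rw [Finset.prod_empty, hgm.eq_one_of_isUnit hu]⟩
    obtain ⟨q, hqi, hqg⟩ := WfDvdMonoid.exists_irreducible_factor hu hgm.ne_zero
    have hlc : IsUnit q.leadingCoeff := by
      obtain ⟨h, rfl⟩ := hqg
      rw [Monic, leadingCoeff_mul] at hgm
      exact IsUnit.of_mul_eq_one _ hgm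
    obtain ⟨c, hc⟩ := hlc.exists_left_inv
    have hcu : IsUnit (C c : ℤ_[p][X]) := isUnit_C.2 (IsUnit.of_mul_eq_one _ hc)
    obtain ⟨f, hf⟩ : ∃ f, f = C c * q := ⟨_, rfl⟩
    have hfm : f.Monic := by
      rw [hf, Monic, leadingCoeff_C_mul_of_isUnit (isUnit_C.1 hcu), hc]
    have hfi : Irreducible f := hf ▸ (irreducible_isUnit_mul hcu).2 hqi
    have hfg : f ∣ g := hf ▸ (hcu.mul_left_dvd).2 hqg
    obtain ⟨h, rfl⟩ := hfg
    have hhm : h.Monic := hfm.of_mul_monic_left hgm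
    have hfd : 0 < f.natDegree := by
      refine Nat.pos_of_ne_zero fun h0 => hfi.not_isUnit ?_
      rw [hfm.natDegree_eq_zero.1 h0]
      exact isUnit_one
    have hlt : h.natDegree < d := by
      rw [← hgd, hfm.natDegree_mul hhm]
      exact Nat.lt_add_of_pos_left hfd
    obtain ⟨S, hS⟩ := ih h.natDegree hlt h rfl hhm
      ((dvd_mul_left _ _).trans hg)
    obtain ⟨f', hf'⟩ : ∃ f' : Cyc p, (f' : ℤ_[p][X]) = f :=
      ⟨⟨f, hfm, hfi, m, hm1, hm, (dvd_mul_right _ _).trans hg⟩, rfl⟩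
    have hnot : f' ∉ S := by
      intro hmem
      have hco : IsCoprime f h := isCoprime_of_mul_dvd_X_pow_sub_one
        (PadicInt.isUnit_natCast_of_coprime hm) (Nat.one_le_iff_ne_zero.1 hm1) hg
      have hd : f ∣ h := by
        rw [← hf', ← hS]
        exact Finset.dvd_prod_of_mem (fun f : Cyc p => (f : ℤ_[p][X])) hmem
      exact hfi.not_isUnit (hco.isUnit_of_dvd' dvd_rfl hd)
    exact ⟨insert f' S, by rw [Finset.prod_insert hnot, hS, hf']⟩

end Coprimality

/-! ### The rings `ℤ_p[x₁]/(f₁) ⊗ ℤ_p[x₂]/(f₂)` -/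

namespace CycTensor

variable {p : ℕ} [Fact p.Prime] (f : Cyc p × Cyc p)

/-- The two polynomials, indexed like the two roots. -/
def poly : Fin 2 → Cyc p := ![f.1, f.2]

instance : IsModuleTopology ℤ_[p] (CycTensor f) := ⟨rfl⟩

instance : Module.Finite ℤ_[p] (CycTensor f) :=
  have := f.1.2.1.finite_adjoinRoot
  have := f.2.2.1.finite_adjoinRoot
  inferInstanceAs (Module.Finite ℤ_[p]
    (AdjoinRoot (f.1 : ℤ_[p][X]) ⊗[ℤ_[p]] AdjoinRoot (f.2 : ℤ_[p][X])))

instance : Module.Free ℤ_[p] (CycTensor f) :=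
  have := f.1.2.1.free_adjoinRoot
  have := f.2.2.1.free_adjoinRoot
  inferInstanceAs (Module.Free ℤ_[p]
    (AdjoinRoot (f.1 : ℤ_[p][X]) ⊗[ℤ_[p]] AdjoinRoot (f.2 : ℤ_[p][X])))

instance : IsTopologicalRing (CycTensor f) :=
  PadicInt.finite_moduleTopology_isTopologicalRing p _

instance : CompactSpace (CycTensor f) := PadicInt.finite_moduleTopology_compactSpace p _

instance : T2Space (CycTensor f) := PadicInt.finite_moduleTopology_t2Space p _

instance : IsLinearTopology (CycTensor f) (CycTensor f) :=
  PadicInt.finite_moduleTopology_isLinearTopology p _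

theorem aeval_root (j : Fin 2) : aeval (root f j) (poly f j : ℤ_[p][X]) = 0 := by
  fin_cases j
  · change aeval ((Algebra.TensorProduct.includeLeft :
      AdjoinRoot (f.1 : ℤ_[p][X]) →ₐ[ℤ_[p]] _ ⊗[ℤ_[p]] AdjoinRoot (f.2 : ℤ_[p][X]))
      (AdjoinRoot.root (f.1 : ℤ_[p][X]))) (f.1 : ℤ_[p][X]) = 0
    rw [aeval_algHom_apply, AdjoinRoot.aeval_eq, AdjoinRoot.mk_self, map_zero]
  · change aeval ((Algebra.TensorProduct.includeRight :
      AdjoinRoot (f.2 : ℤ_[p][X]) →ₐ[ℤ_[p]] AdjoinRoot (f.1 : ℤ_[p][X]) ⊗[ℤ_[p]] _)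
      (AdjoinRoot.root (f.2 : ℤ_[p][X]))) (f.2 : ℤ_[p][X]) = 0
    rw [aeval_algHom_apply, AdjoinRoot.aeval_eq, AdjoinRoot.mk_self, map_zero]

theorem exists_root_pow_eq_one : ∃ m : ℕ, 1 ≤ m ∧ m.Coprime p ∧ ∀ j, root f j ^ m = 1 := by
  have h : ∀ j, ∃ m : ℕ, 1 ≤ m ∧ m.Coprime p ∧ root f j ^ m = 1 := fun j => by
    obtain ⟨-, -, m, hm1, hm, q, hq⟩ := (poly f j).2
    refine ⟨m, hm1, hm, ?_⟩
    have := congrArg (aeval (root f j)) hq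
    rwa [map_mul, aeval_root, zero_mul, map_sub, map_pow, aeval_X, map_one, sub_eq_zero] at this
  obtain ⟨m, hm1, hm, h0⟩ := h 0
  obtain ⟨n, hn1, hn, h1⟩ := h 1
  refine ⟨m * n, Nat.mul_pos hm1 hn1, hm.mul_left hn, fun j => ?_⟩
  fin_cases j
  · change root f 0 ^ (m * n) = 1
    rw [pow_mul, h0, one_pow]
  · change root f 1 ^ (m * n) = 1
    rw [mul_comm, pow_mul, h1, one_pow]

theorem adjoin_range_root : Algebra.adjoin ℤ_[p] (Set.range (root f)) = ⊤ := by
  let T := Algebra.adjoin ℤ_[p] (Set.range (root f))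
  have hT : ∀ j, root f j ∈ T := fun j => Algebra.subset_adjoin ⟨j, rfl⟩
  let ιl : AdjoinRoot (f.1 : ℤ_[p][X]) →ₐ[ℤ_[p]] CycTensor f := Algebra.TensorProduct.includeLeft
  let ιr : AdjoinRoot (f.2 : ℤ_[p][X]) →ₐ[ℤ_[p]] CycTensor f := Algebra.TensorProduct.includeRight
  have hl : ∀ x, ιl x ∈ T := fun x => by
    obtain ⟨g, rfl⟩ := AdjoinRoot.mk_surjective x
    rw [← AdjoinRoot.aeval_eq, ← aeval_algHom_apply]
    exact (Algebra.adjoin_le (Set.singleton_subset_iff.2 (hT 0)) :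
      Algebra.adjoin ℤ_[p] {root f 0} ≤ T) (aeval_mem_adjoin_singleton _ _)
  have hr : ∀ x, ιr x ∈ T := fun x => by
    obtain ⟨g, rfl⟩ := AdjoinRoot.mk_surjective x
    rw [← AdjoinRoot.aeval_eq, ← aeval_algHom_apply]
    exact (Algebra.adjoin_le (Set.singleton_subset_iff.2 (hT 1)) :
      Algebra.adjoin ℤ_[p] {root f 1} ≤ T) (aeval_mem_adjoin_singleton _ _)
  refine (Algebra.eq_top_iff).2 fun x => ?_
  change x ∈ T
  induction x using TensorProduct.induction_on with
  | zero => exact T.zero_mem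
  | add x y hx hy => exact T.add_mem hx hy
  | tmul x y =>
    have : x ⊗ₜ[ℤ_[p]] y = (ιl x * ιr y : CycTensor f) := by
      have h := Algebra.TensorProduct.tmul_mul_tmul (R := ℤ_[p]) x 1 1 y
      rw [mul_one, one_mul] at h
      exact h.symm
    rw [this]
    exact T.mul_mem (hl x) (hr y)

/-- The universal property: a homomorphism is given by roots of the two polynomials. -/
theorem exists_lift {F : Type*} [CommRing F] [Algebra ℤ_[p] F] (t : Fin 2 → F)
    (ht : ∀ j, aeval (t j) (poly f j : ℤ_[p][X]) = 0) :
    ∃ h : CycTensor f →ₐ[ℤ_[p]] F, ∀ j, h (root f j) = t j := by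
  let hl : AdjoinRoot (f.1 : ℤ_[p][X]) →ₐ[ℤ_[p]] F :=
    AdjoinRoot.liftAlgHom (f.1 : ℤ_[p][X]) (Algebra.ofId _ _) (t 0) (ht 0)
  let hr : AdjoinRoot (f.2 : ℤ_[p][X]) →ₐ[ℤ_[p]] F :=
    AdjoinRoot.liftAlgHom (f.2 : ℤ_[p][X]) (Algebra.ofId _ _) (t 1) (ht 1)
  refine ⟨(Algebra.TensorProduct.productMap hl hr :), fun j => ?_⟩
  fin_cases j
  · change Algebra.TensorProduct.productMap hl hr (_ ⊗ₜ _) = t 0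
    rw [Algebra.TensorProduct.productMap_left_apply]
    exact AdjoinRoot.liftAlgHom_root _ _ _ _
  · change Algebra.TensorProduct.productMap hl hr (_ ⊗ₜ _) = t 1
    rw [Algebra.TensorProduct.productMap_right_apply]
    exact AdjoinRoot.liftAlgHom_root _ _ _ _

theorem isUnit_root (j : Fin 2) : IsUnit (root f j) := by
  obtain ⟨m, hm1, -, h⟩ := exists_root_pow_eq_one f
  exact IsUnit.of_pow_eq_one (h j) (by omega)

/-- An element of `Cyc p` other than the `j`-th polynomial takes a unit value at the `j`-th root,
being coprime to that polynomial. -/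
theorem isUnit_aeval_root {g : Cyc p} {j : Fin 2} (h : poly f j ≠ g) :
    IsUnit (aeval (root f j) (g : ℤ_[p][X])) := by
  obtain ⟨a, b, hab⟩ := Cyc.isCoprime (poly f j).2 g.2 (fun h' => h (Subtype.ext h'))
  have := congrArg (aeval (root f j)) hab
  rw [map_add, map_mul, map_mul, aeval_root, mul_zero, zero_add, map_one] at this
  exact IsUnit.of_mul_eq_one_right _ this

/-- The element `x_j (1 + s_j)`. -/
noncomputable def unitCoord (j : Fin 2) : MvPowerSeries (Fin 2) (CycTensor f) :=
  MvPowerSeries.C (root f j) * (1 + MvPowerSeries.X j)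

theorem constantCoeff_unitCoord (j : Fin 2) :
    MvPowerSeries.constantCoeff (unitCoord f j) = root f j := by
  simp [unitCoord]

theorem isUnit_unitCoord (j : Fin 2) : IsUnit (unitCoord f j) := by
  rw [MvPowerSeries.isUnit_iff_constantCoeff, constantCoeff_unitCoord]
  exact isUnit_root f j

end CycTensor

namespace MvPowerSeries

variable {σ R : Type*} [TopologicalSpace R]

theorem compactSpace [CompactSpace R] : CompactSpace (MvPowerSeries σ R) :=
  inferInstanceAs (CompactSpace ((σ →₀ ℕ) → R))

end MvPowerSeries

/-! ### The polynomial ring in the product of power series rings -/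

/-- The product of the power series rings over the rings `ℤ_p[x₁]/(f₁) ⊗ ℤ_p[x₂]/(f₂)`. -/
abbrev CycProduct : Type :=
  ∀ (p : Nat.Primes) (f : Cyc p × Cyc p), MvPowerSeries (Fin 2) (CycTensor f)

namespace CycProduct

/-- The element with all components `x_j (1 + s_j)`. -/
noncomputable def unitCoord (j : Fin 2) : CycProduct := fun _ f => CycTensor.unitCoord f j

/-- The homomorphism from `ℤ[x₁, x₂]` sending the variables to the elements `x_j (1 + s_j)`. -/
noncomputable def polyMap : MvPolynomial (Fin 2) ℤ →ₐ[ℤ] CycProduct :=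
  MvPolynomial.aeval unitCoord

instance : IsLinearTopology CycProduct CycProduct :=
  have : ∀ p : Nat.Primes, IsLinearTopology
      (∀ f : Cyc p × Cyc p, MvPowerSeries (Fin 2) (CycTensor f))
      (∀ f : Cyc p × Cyc p, MvPowerSeries (Fin 2) (CycTensor f)) := fun _ => Pi.isLinearTopology
  Pi.isLinearTopology

instance : CompactSpace CycProduct :=
  have : ∀ (p : Nat.Primes) (f : Cyc p × Cyc p),
      CompactSpace (MvPowerSeries (Fin 2) (CycTensor f)) := fun _ _ => MvPowerSeries.compactSpace
  inferInstance

theorem isUnit_unitCoord (j : Fin 2) : IsUnit (unitCoord j) :=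
  Pi.isUnit_iff.2 fun _ => Pi.isUnit_iff.2 fun f => CycTensor.isUnit_unitCoord f j

end CycProduct

/-! ### Continuity of evaluations -/

section Evaluation

variable {p : ℕ} [Fact p.Prime]

/-- Evaluation of power series over `ℤ_p[x₁]/(f₁) ⊗ ℤ_p[x₂]/(f₂)` in a ring in which `p` is
nilpotent, at roots `t_j` of the polynomials and unipotent elements `w_j`. -/
theorem CycTensor.exists_ringHom_isOpen_ker (f : Cyc p × Cyc p) {F : Type*} [CommRing F]
    [Algebra ℤ_[p] F] {k : ℕ} (hk : (p : F) ^ k = 0)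
    (t w : Fin 2 → F) (ht : ∀ j, aeval (t j) (poly f j : ℤ_[p][X]) = 0)
    (hw : ∀ j, IsNilpotent (w j - 1)) :
    ∃ ε : MvPowerSeries (Fin 2) (CycTensor f) →+* F,
      (∀ᶠ g in 𝓝 0, ε g = 0) ∧ ∀ j, ε (unitCoord f j) = t j * w j := by
  obtain ⟨h, hh⟩ := exists_lift f t ht
  let _ : UniformSpace F := ⊥
  have hd : DiscreteUniformity F := ⟨rfl⟩
  have hc : Continuous (h : CycTensor f →+* F) := by
    refine continuous_of_continuousAt_zero _ ?_
    rw [ContinuousAt, map_zero, nhds_discrete F, tendsto_pure]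
    refine mem_of_superset
      ((PadicInt.isOpen_range_pow_mul p (CycTensor f) k).mem_nhds ⟨0, by simp⟩) ?_
    rintro _ ⟨b, rfl⟩
    change h _ = 0
    rw [map_mul, map_pow, map_natCast, hk, zero_mul]
  let _ : UniformSpace (CycTensor f) := IsTopologicalAddGroup.rightUniformSpace _
  have : IsUniformAddGroup (CycTensor f) := isUniformAddGroup_of_addCommGroup
  have ha : MvPowerSeries.HasEval fun j => w j - 1 :=
    ⟨fun j => by
      obtain ⟨n, hn⟩ := hw j
      refine tendsto_atTop_of_eventually_const (i₀ := n) fun i hi => ?_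
      exact pow_eq_zero_of_le hi hn, by simp⟩
  refine ⟨MvPowerSeries.eval₂Hom hc ha, ?_, fun j => ?_⟩
  · have h := (MvPowerSeries.continuous_eval₂ hc ha).tendsto 0
    rw [← MvPowerSeries.coe_eval₂Hom hc ha, map_zero, nhds_discrete F, tendsto_pure] at h
    exact h
  · rw [unitCoord, map_mul, map_add, map_one, MvPowerSeries.coe_eval₂Hom hc ha,
      MvPowerSeries.eval₂_C, MvPowerSeries.eval₂_X, add_sub_cancel]
    exact congrArg (· * w j) (hh j)

theorem exists_algebra_padicInt {F : Type*} [CommRing F] {k : ℕ} (hk : (p : F) ^ k = 0) :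
    Nonempty (Algebra ℤ_[p] F) := by
  have : ((p ^ k : ℕ) : F) = 0 := by rw [Nat.cast_pow, hk]
  exact ⟨((ZMod.castHom (ringChar.dvd this) F).comp (PadicInt.toZModPow k)).toAlgebra⟩

theorem eq_zero_of_prod_eq_zero_of_forall_dvd {G ι : Type*} [CommRing G] {S : Finset ι} {c : ι → G}
    (hc : ∀ i ∈ S, ∀ j ∈ S, i ≠ j → IsCoprime (c i) (c j)) (hS : ∏ i ∈ S, c i = 0) {z : G}
    (hz : ∀ i ∈ S, c i ∣ z) : z = 0 := by
  have := Finset.prod_dvd_of_coprime (t := S) (s := c) (z := z)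
    (fun i hi j hj hij => hc i hi j hj hij) hz
  rwa [hS, zero_dvd_iff] at this

/-- The Chinese remainder theorem for two pairwise coprime families with product zero: an element of
all ideals `(c i, d j)` vanishes. -/
theorem eq_zero_of_forall_mem_span_pair {G ι κ : Type*} [CommRing G] {S : Finset ι} {T : Finset κ}
    {c : ι → G} {d : κ → G} (hc : ∀ i ∈ S, ∀ j ∈ S, i ≠ j → IsCoprime (c i) (c j))
    (hd : ∀ i ∈ T, ∀ j ∈ T, i ≠ j → IsCoprime (d i) (d j)) (hS : ∏ i ∈ S, c i = 0)
    (hT : ∏ i ∈ T, d i = 0) {z : G} (hz : ∀ i ∈ S, ∀ j ∈ T, z ∈ Ideal.span {c i, d j}) : z = 0 := by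
  refine eq_zero_of_prod_eq_zero_of_forall_dvd hc hS fun i hi => ?_
  let π := Ideal.Quotient.mk (Ideal.span {c i})
  rw [← Ideal.mem_span_singleton, ← Ideal.Quotient.eq_zero_iff_mem]
  refine eq_zero_of_prod_eq_zero_of_forall_dvd (S := T) (c := fun j => π (d j))
    (fun j hj j' hj' h => (hd j hj j' hj' h).map π) (by rw [← map_prod, hT, map_zero])
    fun j hj => ?_
  obtain ⟨a, b, hab⟩ := Ideal.mem_span_pair.1 (hz i hi j hj)
  refine ⟨π b, ?_⟩
  have hci : π (c i) = 0 := Ideal.Quotient.eq_zero_iff_mem.2 (Ideal.mem_span_singleton_self _)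
  change π z = _
  rw [← hab, map_add, map_mul, map_mul, hci, mul_zero, zero_add, mul_comm]

theorem isNilpotent_sub_one_of_pow_prime_pow {G : Type*} [CommRing G] (hp : IsNilpotent (p : G))
    {w : G} {l : ℕ} (hw : w ^ p ^ l = 1) : IsNilpotent (w - 1) := by
  obtain ⟨r, hr⟩ := exists_add_pow_prime_pow_eq (Fact.out : p.Prime) (w - 1) 1 l
  rw [sub_add_cancel, hw, one_pow] at hr
  have : (w - 1) ^ p ^ l = p * (-((w - 1) * 1 * r)) := by linear_combination -hr
  have h2 : IsNilpotent ((w - 1) ^ p ^ l) := by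
    rw [this]
    exact Commute.isNilpotent_mul_right (Commute.all _ _) hp
  exact h2.of_pow

end Evaluation

namespace CycProduct

/-- Each `x j` is a product of a root of unity `t j` of order prime to `p` and a unipotent element
`w j`. Modulo `(f₁ (t 0), f₂ (t 1))` the evaluation factors through the power series ring belonging
to `(f₁, f₂)`, and the intersection of these ideals over the factors of `x ^ m - 1` is zero. -/
theorem eventually_aeval_eq_zero_of_prime_pow (p : Nat.Primes) {F : Type*} [CommRing F] {k : ℕ}
    (hk : ((p : ℕ) : F) ^ k = 0) (x : Fin 2 → F) {M : ℕ} (hM : M ≠ 0) (hx : ∀ j, x j ^ M = 1) :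
    ∀ᶠ g in comap polyMap (𝓝 0), MvPolynomial.aeval (R := ℤ) x g = 0 := by
  have hp : (p : ℕ).Prime := p.2
  obtain ⟨_⟩ := exists_algebra_padicInt hk
  obtain ⟨l, m, hpm, rfl⟩ := Nat.exists_eq_pow_mul_and_not_dvd hM p hp.ne_one
  have hm0 : m ≠ 0 := fun h => hM (by rw [h, mul_zero])
  have hmp : m.Coprime p := ((Nat.Prime.coprime_iff_not_dvd hp).2 hpm).symm
  -- `t j` and `w j` are the parts of `x j` of order prime to `p` and of `p`-power order
  let e : ℕ := p ^ (m.totient * l)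
  have he1 : e ≡ 1 [MOD m] := by
    change (p : ℕ) ^ (m.totient * l) ≡ 1 [MOD m]
    rw [pow_mul]
    simpa using (Nat.ModEq.pow_totient hmp.symm).pow l
  have hel : (p : ℕ) ^ l ∣ e :=
    pow_dvd_pow _ (Nat.le_mul_of_pos_left l (Nat.totient_pos.2 (Nat.pos_of_ne_zero hm0)))
  let t : Fin 2 → F := fun j => x j ^ e
  let w : Fin 2 → F := fun j => x j * t j ^ (m - 1)
  have ht : ∀ j, t j ^ m = 1 := fun j => by
    obtain ⟨c, hc⟩ := hel
    change (x j ^ e) ^ m = 1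
    rw [← pow_mul, hc, mul_right_comm, pow_mul, hx, one_pow]
  have htw : ∀ j, t j * w j = x j := fun j => by
    change t j * (x j * t j ^ (m - 1)) = x j
    rw [mul_left_comm, mul_pow_sub_one hm0, ht, mul_one]
  have hwp : ∀ j, w j ^ (p : ℕ) ^ l = 1 := fun j => by
    have h1 : (t j * w j) ^ (p : ℕ) ^ l = t j ^ (p : ℕ) ^ l := by
      rw [htw]
      change x j ^ (p : ℕ) ^ l = (x j ^ e) ^ (p : ℕ) ^ l
      rw [← pow_mul]
      refine (pow_eq_pow_of_modEq ?_ (hx j)).symm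
      have := Nat.ModEq.mul_left' ((p : ℕ) ^ l) he1
      rwa [mul_one, mul_comm _ e] at this
    have hu : IsUnit (t j ^ (p : ℕ) ^ l) := (IsUnit.of_pow_eq_one (ht j) hm0).pow _
    rw [mul_pow] at h1
    exact hu.mul_left_cancel (by rw [h1, mul_one])
  have hw : ∀ j, IsNilpotent (w j - 1) := fun j =>
    isNilpotent_sub_one_of_pow_prime_pow ⟨k, hk⟩ (hwp j)
  obtain ⟨S, hS⟩ := Cyc.exists_prod_eq (p := p) (Nat.one_le_iff_ne_zero.2 hm0) hmp
  have hprod : ∀ j, ∏ f ∈ S, aeval (t j) (f : ℤ_[p][X]) = 0 := fun j => by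
    rw [← map_prod, hS, map_sub, map_pow, aeval_X, ht, map_one, sub_self]
  have hcop : ∀ j, ∀ f ∈ S, ∀ f' ∈ S, f ≠ f' →
      IsCoprime (aeval (t j) (f : ℤ_[p][X])) (aeval (t j) (f' : ℤ_[p][X])) :=
    fun j f _ f' _ h => (Cyc.isCoprime f.2 f'.2 fun h' => h (Subtype.ext h')).map
      (aeval (t j) : ℤ_[p][X] →ₐ[ℤ_[p]] F).toRingHom
  have key : ∀ f₁ ∈ S, ∀ f₂ ∈ S, ∀ᶠ g in comap polyMap (𝓝 0), MvPolynomial.aeval (R := ℤ) x g ∈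
      Ideal.span {aeval (t 0) (f₁ : ℤ_[p][X]), aeval (t 1) (f₂ : ℤ_[p][X])} := by
    intro f₁ _ f₂ _
    let I := Ideal.span {aeval (t 0) (f₁ : ℤ_[p][X]), aeval (t 1) (f₂ : ℤ_[p][X])}
    let π : F →ₐ[ℤ_[p]] F ⧸ I := Ideal.Quotient.mkₐ ℤ_[p] I
    have hπ : ∀ {z}, π z = 0 ↔ z ∈ I := Ideal.Quotient.eq_zero_iff_mem
    obtain ⟨ε, hε, hεu⟩ := CycTensor.exists_ringHom_isOpen_ker (f₁, f₂) (F := F ⧸ I) (k := k)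
      (by rw [← map_natCast π, ← map_pow, hk, map_zero]) (fun j => π (t j)) (fun j => π (w j))
      (fun j => by
        rw [aeval_algHom_apply, hπ]
        fin_cases j
        · exact Ideal.subset_span (Set.mem_insert _ _)
        · exact Ideal.subset_span (Set.mem_insert_of_mem _ rfl))
      (fun j => by
        have := (hw j).map π
        rwa [map_sub, map_one] at this)
    have hcomp : ∀ g : MvPolynomial (Fin 2) ℤ,
        ε (polyMap g p (f₁, f₂)) = π (MvPolynomial.aeval (R := ℤ) x g) := by
      intro g
      have : (ε.comp ((Pi.evalRingHom _ (f₁, f₂)).comp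
          (Pi.evalRingHom (fun p : Nat.Primes => ∀ f : Cyc p × Cyc p,
            MvPowerSeries (Fin 2) (CycTensor f)) p))).comp polyMap.toRingHom =
          (π : F →+* F ⧸ I).comp (MvPolynomial.aeval (R := ℤ) x).toRingHom := by
        refine MvPolynomial.ringHom_ext (fun n => by simp) fun j => ?_
        have h1 : polyMap (MvPolynomial.X j) = unitCoord j := MvPolynomial.aeval_X _ j
        have h2 : MvPolynomial.aeval (R := ℤ) x (MvPolynomial.X j) = x j :=
          MvPolynomial.aeval_X _ j
        change ε (polyMap (MvPolynomial.X j) p (f₁, f₂)) =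
          π (MvPolynomial.aeval (R := ℤ) x (MvPolynomial.X j))
        rw [h1, h2]
        change ε (CycTensor.unitCoord (f₁, f₂) j) = _
        rw [hεu, ← map_mul, htw]
      exact RingHom.congr_fun this g
    have hcont : Continuous fun r : CycProduct => r p (f₁, f₂) := by fun_prop
    have h0 : ∀ᶠ r : CycProduct in 𝓝 0, ε (r p (f₁, f₂)) = 0 :=
      (hcont.tendsto' 0 0 rfl).eventually hε
    filter_upwards [tendsto_comap.eventually h0] with g hg
    rw [← hπ, ← hcomp]
    exact hg
  have key' : ∀ᶠ g in comap polyMap (𝓝 0), ∀ f₁ ∈ S, ∀ f₂ ∈ S, MvPolynomial.aeval (R := ℤ) x g ∈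
      Ideal.span {aeval (t 0) (f₁ : ℤ_[p][X]), aeval (t 1) (f₂ : ℤ_[p][X])} := by
    rw [Filter.eventually_all_finset]
    intro f₁ h₁
    rw [Filter.eventually_all_finset]
    exact key f₁ h₁
  filter_upwards [key'] with g hg
  exact eq_zero_of_forall_mem_span_pair (hcop 0) (hcop 1) (hprod 0) (hprod 1) hg

/-- Evaluation at two elements of finite order of a ring of positive characteristic is continuous
for the topology on `ℤ[x₁, x₂]` induced by the product of power series rings. -/
theorem eventually_aeval_eq_zero {F : Type*} [CommRing F] {n : ℕ} (hn0 : n ≠ 0) (hn : (n : F) = 0)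
    (x : Fin 2 → F) {M : ℕ} (hM : M ≠ 0) (hx : ∀ j, x j ^ M = 1) :
    ∀ᶠ g in comap polyMap (𝓝 0), MvPolynomial.aeval (R := ℤ) x g = 0 := by
  -- modulo each prime power divisor of `n`, the prime power case applies
  have key : ∀ q ∈ n.primeFactors, ∀ᶠ g in comap polyMap (𝓝 0),
      ((q ^ n.factorization q : ℕ) : F) ∣ MvPolynomial.aeval (R := ℤ) x g := by
    intro q hq
    let I := Ideal.span {((q ^ n.factorization q : ℕ) : F)}
    let π := Ideal.Quotient.mk I
    have := eventually_aeval_eq_zero_of_prime_pow ⟨q, Nat.prime_of_mem_primeFactors hq⟩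
      (F := F ⧸ I) (k := n.factorization q)
      (by
        have : π ((q ^ n.factorization q : ℕ) : F) = 0 :=
          Ideal.Quotient.eq_zero_iff_mem.2 (Ideal.mem_span_singleton_self _)
        simpa using this) (fun j => π (x j)) hM
      (fun j => by rw [← map_pow, hx, map_one])
    filter_upwards [this] with g hg
    rw [← Ideal.mem_span_singleton, ← Ideal.Quotient.eq_zero_iff_mem, ← hg]
    exact (MvPolynomial.comp_aeval_apply (σ := Fin 2) (f := x) (π.toIntAlgHom) g)
  rw [← Filter.eventually_all_finset] at key
  filter_upwards [key] with g hg
  refine eq_zero_of_prod_eq_zero_of_forall_dvd (S := n.primeFactors) (fun i hi j hj hij => ?_) ?_ hg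
  · have : Nat.Coprime (i ^ n.factorization i) (j ^ n.factorization j) :=
      Nat.Coprime.pow _ _ ((Nat.coprime_primes (Nat.prime_of_mem_primeFactors hi)
        (Nat.prime_of_mem_primeFactors hj)).2 hij)
    exact this.cast
  · rw [← Nat.cast_prod]
    have : ∏ q ∈ n.primeFactors, q ^ n.factorization q = n :=
      Nat.prod_factorization_pow_eq_self hn0
    rw [this, hn]

end CycProduct

/-! ### Density of the polynomial ring -/

section Density

variable {p : ℕ} [Fact p.Prime]

theorem CycTensor.isTopologicallyNilpotent_of_constantCoeff (f : Cyc p × Cyc p)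
    {z : MvPowerSeries (Fin 2) (CycTensor f)}
    (hz : IsTopologicallyNilpotent (MvPowerSeries.constantCoeff z)) : IsTopologicallyNilpotent z :=
  MvPowerSeries.LinearTopology.isTopologicallyNilpotent_of_constantCoeff hz

/-- Within one factor, a closed subring containing `ℤ_p` and the elements `x_j (1 + s_j)` contains
the roots of unity `x_j`, hence the coefficient ring and the variables `s_j`. -/
theorem Subring.eq_top_of_unitCoord_mem (f : Cyc p × Cyc p)
    {C : Subring (MvPowerSeries (Fin 2) (CycTensor f))}
    (hC : IsClosed (C : Set (MvPowerSeries (Fin 2) (CycTensor f))))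
    (hz : ∀ z : ℤ_[p], MvPowerSeries.C (algebraMap ℤ_[p] (CycTensor f) z) ∈ C)
    (hu : ∀ j, CycTensor.unitCoord f j ∈ C) : C = ⊤ := by
  have : CompactSpace (MvPowerSeries (Fin 2) (CycTensor f)) := MvPowerSeries.compactSpace
  obtain ⟨m, hm1, hmp, hm⟩ := CycTensor.exists_root_pow_eq_one f
  have hroot : ∀ j, MvPowerSeries.C (CycTensor.root f j) ∈ C := fun j => by
    refine Subring.mem_of_mul_principalUnit_mem hC (p := p) (w := 1 + MvPowerSeries.X j) hmp
      ?_ ?_ ?_ (hu j)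
    · rw [← map_pow, hm, map_one]
    · refine CycTensor.isTopologicallyNilpotent_of_constantCoeff f ?_
      rw [map_natCast]
      exact PadicInt.isTopologicallyNilpotent_natCast p _
    · rw [add_sub_cancel_left]
      exact MvPowerSeries.WithPiTopology.isTopologicallyNilpotent_of_constantCoeff_zero
        (MvPowerSeries.constantCoeff_X j)
  have hX : ∀ j, MvPowerSeries.X j ∈ C := fun j => by
    have h1 : (MvPowerSeries.X j : MvPowerSeries (Fin 2) (CycTensor f)) =
        MvPowerSeries.C (CycTensor.root f j) ^ (m - 1) * CycTensor.unitCoord f j - 1 := by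
      rw [CycTensor.unitCoord, ← mul_assoc, pow_sub_one_mul (by omega), ← map_pow, hm, map_one,
        one_mul, add_sub_cancel_left]
    rw [h1]
    exact C.sub_mem (C.mul_mem (C.pow_mem (hroot j) _) (hu j)) C.one_mem
  have hcoef : ∀ b, MvPowerSeries.C b ∈ C := fun b => by
    have hb : b ∈ Algebra.adjoin ℤ_[p] (Set.range (CycTensor.root f)) :=
      CycTensor.adjoin_range_root f ▸ Algebra.mem_top
    induction hb using Algebra.adjoin_induction with
    | mem x hx => obtain ⟨j, rfl⟩ := hx; exact hroot j
    | algebraMap z => exact hz z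
    | add x y _ _ hx hy => rw [map_add]; exact C.add_mem hx hy
    | mul x y _ _ hx hy => rw [map_mul]; exact C.mul_mem hx hy
  have hpoly : ∀ g : MvPolynomial (Fin 2) (CycTensor f),
      (g : MvPowerSeries (Fin 2) (CycTensor f)) ∈ C := fun g => by
    induction g using MvPolynomial.induction_on with
    | C b => rw [MvPolynomial.coe_C]; exact hcoef b
    | add x y hx hy => rw [MvPolynomial.coe_add]; exact C.add_mem hx hy
    | mul_X x j hx => rw [MvPolynomial.coe_mul, MvPolynomial.coe_X]; exact C.mul_mem hx (hX j)
  refine eq_top_iff.2 fun x _ => ?_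
  have hd := MvPowerSeries.WithPiTopology.denseRange_toMvPowerSeries (σ := Fin 2)
    (R := CycTensor f) x
  have hsub : Set.range (MvPolynomial.toMvPowerSeries : MvPolynomial (Fin 2) (CycTensor f) → _) ⊆
      (C : Set _) := by
    rintro _ ⟨g, rfl⟩
    exact hpoly g
  exact hC.closure_subset_iff.2 hsub hd

/-- The constants from `ℤ_p` in the part over `p` of the product of power series rings. -/
noncomputable def padicConst (p : ℕ) [Fact p.Prime] :
    ℤ_[p] →+* ∀ f : Cyc p × Cyc p, MvPowerSeries (Fin 2) (CycTensor f) :=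
  RingHom.pi fun _ => MvPowerSeries.C.comp (algebraMap _ _)

theorem continuous_padicConst : Continuous (padicConst p) :=
  continuous_pi fun f => MvPowerSeries.WithPiTopology.continuous_C.comp
    (continuous_algebraMap ℤ_[p] (CycTensor f))

/-- Within the part over `p`, the values at `x_j (1 + s_j)` of an element of `Cyc p` are
topologically nilpotent in the factors where it is the `j`-th polynomial and units in all others.
So a closed subring containing these elements contains the idempotents of the single factors. -/
theorem Subring.eq_top_of_unitCoord_mem_pi
    {C : Subring (∀ f : Cyc p × Cyc p, MvPowerSeries (Fin 2) (CycTensor f))}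
    (hC : IsClosed (C : Set (∀ f : Cyc p × Cyc p, MvPowerSeries (Fin 2) (CycTensor f))))
    (hu : ∀ j, (fun f => CycTensor.unitCoord f j) ∈ C) : C = ⊤ := by
  classical
  have : ∀ f : Cyc p × Cyc p, CompactSpace (MvPowerSeries (Fin 2) (CycTensor f)) :=
    fun _ => MvPowerSeries.compactSpace
  have hz : ∀ z, padicConst p z ∈ C := by
    have h1 : IsClosed {z | padicConst p z ∈ C} := hC.preimage continuous_padicConst
    have h2 : Set.range (Int.cast : ℤ → ℤ_[p]) ⊆ {z | padicConst p z ∈ C} := by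
      rintro _ ⟨k, rfl⟩
      change padicConst p k ∈ C
      rw [map_intCast]
      exact intCast_mem C k
    exact fun z => h1.closure_subset_iff.2 h2 (PadicInt.denseRange_intCast z)
  -- the idempotent cutting out the factors with `g` not the `j`-th polynomial
  have hidem : ∀ (g : Cyc p) (j : Fin 2),
      (fun f : Cyc p × Cyc p => if CycTensor.poly f j = g then 0 else 1) ∈ C := by
    intro g j
    let v : ∀ f : Cyc p × Cyc p, MvPowerSeries (Fin 2) (CycTensor f) :=
      eval₂ (padicConst p) (fun f => CycTensor.unitCoord f j) (g : ℤ_[p][X])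
    have hvC : v ∈ C := by
      have h := eval₂_eq_sum_range (padicConst p)
        (fun f : Cyc p × Cyc p => CycTensor.unitCoord f j) (p := (g : ℤ_[p][X]))
      change eval₂ _ _ _ ∈ C
      rw [h]
      exact C.sum_mem fun i _ => C.mul_mem (hz _) (C.pow_mem (hu j) i)
    have hvc : ∀ f, MvPowerSeries.constantCoeff (v f) =
        aeval (CycTensor.root f j) (g : ℤ_[p][X]) := by
      intro f
      have h1 : v f = eval₂ (MvPowerSeries.C.comp (algebraMap _ _)) (CycTensor.unitCoord f j)
          (g : ℤ_[p][X]) :=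
        hom_eval₂ (g : ℤ_[p][X]) (padicConst p) (Pi.evalRingHom _ f) _
      rw [h1, hom_eval₂, CycTensor.constantCoeff_unitCoord, aeval_def]
      congr 1
    refine Subring.mem_of_unit_add_topologicallyNilpotent hC
      (u := fun f => if CycTensor.poly f j = g then 1 else v f)
      (z := fun f => if CycTensor.poly f j = g then v f else 0) ?_ ?_ ?_ ?_
    · ext1 f
      simp only [Pi.mul_apply]
      split_ifs <;> simp
    · refine Pi.isUnit_iff.2 fun f => ?_
      split_ifs with h
      · exact isUnit_one
      · rw [MvPowerSeries.isUnit_iff_constantCoeff, hvc]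
        exact CycTensor.isUnit_aeval_root f h
    · refine tendsto_pi_nhds.2 fun f => ?_
      simp only [Pi.pow_apply, Pi.zero_apply]
      split_ifs with h
      · refine MvPowerSeries.WithPiTopology.isTopologicallyNilpotent_of_constantCoeff_zero ?_
        rw [hvc, ← h, CycTensor.aeval_root]
      · exact IsTopologicallyNilpotent.zero
    · convert hvC using 1
      ext1 f
      simp only [Pi.add_apply, Pi.mul_apply, Pi.sub_apply, Pi.one_apply]
      split_ifs <;> simp
  have hsingle : ∀ f, Pi.single f 1 ∈ C := by
    intro f
    have h : (Pi.single f 1 : ∀ f : Cyc p × Cyc p, MvPowerSeries (Fin 2) (CycTensor f)) =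
        (1 - fun f' : Cyc p × Cyc p => if CycTensor.poly f' 0 = f.1 then 0 else 1) *
        (1 - fun f' : Cyc p × Cyc p => if CycTensor.poly f' 1 = f.2 then 0 else 1) := by
      ext1 f'
      simp only [Pi.mul_apply, Pi.sub_apply, Pi.one_apply]
      by_cases hf : f' = f
      · subst hf
        have h0 : CycTensor.poly f' 0 = f'.1 := rfl
        have h1 : CycTensor.poly f' 1 = f'.2 := rfl
        rw [Pi.single_eq_same, if_pos h0, if_pos h1]
        simp
      · rw [Pi.single_eq_of_ne hf]
        by_cases h0 : f'.1 = f.1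
        · have h1 : CycTensor.poly f' 1 ≠ f.2 := fun h1 => hf (Prod.ext h0 h1)
          rw [if_neg h1, sub_self, mul_zero]
        · have h1 : CycTensor.poly f' 0 ≠ f.1 := h0
          rw [if_neg h1, sub_self, zero_mul]
    rw [h]
    exact C.mul_mem (C.sub_mem C.one_mem (hidem _ _)) (C.sub_mem C.one_mem (hidem _ _))
  refine Subring.eq_top_of_single_mem hC fun f r => ?_
  have htop : C.piTrace f (hsingle f) = ⊤ := by
    refine Subring.eq_top_of_unitCoord_mem f (Subring.isClosed_piTrace hC f (hsingle f))
      (fun z => ?_) fun j => ?_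
    · exact Subring.apply_mem_piTrace f (hsingle f) (hz z)
    · exact Subring.apply_mem_piTrace f (hsingle f) (hu j)
  have : r ∈ C.piTrace f (hsingle f) := htop ▸ Subring.mem_top r
  exact this

/-- The prime `p` is topologically nilpotent in the part over `p` and a unit in all others, so that
a closed subring contains the idempotents of these parts. -/
theorem Subring.eq_top_of_unitCoord_mem_cycProduct {C : Subring CycProduct}
    (hC : IsClosed (C : Set CycProduct)) (hu : ∀ j, CycProduct.unitCoord j ∈ C) : C = ⊤ := by
  classical
  have hsingle : ∀ p, Pi.single p 1 ∈ C := by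
    intro p
    have h1 : (1 - Pi.single p 1 : CycProduct) ∈ C := by
      have he : (1 - Pi.single p 1 : CycProduct) = fun q => if q = p then 0 else 1 := by
        ext1 q
        rw [Pi.sub_apply, Pi.one_apply]
        split_ifs with h
        · subst h; rw [Pi.single_eq_same, sub_self]
        · rw [Pi.single_eq_of_ne h, sub_zero]
      rw [he]
      refine Subring.mem_of_unit_add_topologicallyNilpotent hC
        (u := fun q => if q = p then 1 else (p : ℕ))
        (z := fun q => if q = p then (p : ℕ) else 0) ?_ ?_ ?_ ?_
      · ext1 q
        simp only [Pi.mul_apply]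
        split_ifs <;> simp
      · refine Pi.isUnit_iff.2 fun q => ?_
        split_ifs with h
        · exact isUnit_one
        · have hcop : (p : ℕ).Coprime q :=
            (Nat.coprime_primes p.2 q.2).2 fun h' => h (Subtype.ext h'.symm)
          have h2 := (PadicInt.isUnit_natCast_of_coprime hcop).map (padicConst q)
          rwa [map_natCast] at h2
      · refine tendsto_pi_nhds.2 fun q => tendsto_pi_nhds.2 fun f => ?_
        simp only [Pi.pow_apply, Pi.zero_apply]
        split_ifs with h
        · subst h
          refine CycTensor.isTopologicallyNilpotent_of_constantCoeff f ?_
          rw [Pi.natCast_apply, map_natCast]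
          exact PadicInt.isTopologicallyNilpotent_natCast q _
        · exact IsTopologicallyNilpotent.zero
      · convert natCast_mem C (p : ℕ) using 1
        ext1 q
        simp only [Pi.add_apply, Pi.mul_apply, Pi.sub_apply, Pi.one_apply, Pi.natCast_apply]
        split_ifs <;> simp
    have := C.sub_mem C.one_mem h1
    rwa [sub_sub_cancel] at this
  refine Subring.eq_top_of_single_mem hC fun p r => ?_
  have htop : C.piTrace p (hsingle p) = ⊤ :=
    Subring.eq_top_of_unitCoord_mem_pi (Subring.isClosed_piTrace hC p (hsingle p)) fun j =>
      Subring.apply_mem_piTrace p (hsingle p) (hu j)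
  have : r ∈ C.piTrace p (hsingle p) := htop ▸ Subring.mem_top r
  exact this

theorem CycProduct.denseRange_polyMap : DenseRange CycProduct.polyMap := by
  have htop : (CycProduct.polyMap.toRingHom.range).topologicalClosure = ⊤ :=
    Subring.eq_top_of_unitCoord_mem_cycProduct (Subring.isClosed_topologicalClosure _) fun j =>
      Subring.le_topologicalClosure _ ⟨MvPolynomial.X j, MvPolynomial.aeval_X _ j⟩
  intro x
  have : x ∈ (CycProduct.polyMap.toRingHom.range).topologicalClosure := htop ▸ Subring.mem_top x
  exact this

end Density

/-! ### The product decomposition -/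

section MainIsomorphism

variable {A : Type*} [CommGroup A] [TopologicalSpace A] [IsTopologicalGroup A]

theorem CompletedGroupAlgebra.tendsto_polyMap [CompactSpace A] (a : Fin 2 → A) :
    Tendsto (CompletedGroupAlgebra.polyMap a) (comap CycProduct.polyMap (𝓝 0)) (𝓝 0) := by
  rw [CompletedGroupAlgebra.tendsto_iff]
  intro i
  obtain ⟨M, n, hn, hM⟩ := CompletedGroupAlgebra.exists_pow_proj_of_eq_one i
  have h := CycProduct.eventually_aeval_eq_zero (F := CGALevel i) n.ne_zero hn
    (fun j => CompletedGroupAlgebra.proj i (CompletedGroupAlgebra.of ZHat (a j))) M.ne_zero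
    fun j => hM _
  refine h.mono fun g hg => ?_
  rw [map_zero, CompletedGroupAlgebra.proj_polyMap]
  exact hg

theorem CycProduct.tendsto_polyMap (hA : Nonempty (A ≃ₜ* Multiplicative (ZHat × ZHat)))
    {a : Fin 2 → A} (ha : (Subgroup.closure (Set.range a)).topologicalClosure = ⊤) :
    Tendsto CycProduct.polyMap (comap (CompletedGroupAlgebra.polyMap a) (𝓝 0)) (𝓝 0) :=
  CompletedGroupAlgebra.tendsto_comap_polyMap hA ha
    (CycProduct.polyMap : MvPolynomial (Fin 2) ℤ →+* CycProduct) fun j => by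
      have : CycProduct.polyMap (MvPolynomial.X j) = CycProduct.unitCoord j :=
        MvPolynomial.aeval_X _ j
      exact this ▸ CycProduct.isUnit_unitCoord j

/-- The completed group algebra and the product of power series rings are completions of `ℤ[x₁, x₂]`
for the same topology. -/
theorem exists_ringEquiv_cycProduct (hA : Nonempty (A ≃ₜ* Multiplicative (ZHat × ZHat)))
    (a : Fin 2 → A) (ha : (Subgroup.closure (Set.range a)).topologicalClosure = ⊤) :
    ∃ Φ : CompletedGroupAlgebra ZHat A ≃+* CycProduct, IsHomeomorph Φ ∧
      ∀ i, Φ (CompletedGroupAlgebra.of ZHat (a i)) = CycProduct.unitCoord i := by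
  have := CompletedGroupAlgebra.compactSpace_of_equiv hA
  have : CompactSpace (CompletedGroupAlgebra ZHat A) := CompletedGroupAlgebra.compactSpace
  obtain ⟨Φ, h, hΦ⟩ := exists_ringEquiv_of_denseRange (CompletedGroupAlgebra.polyMap a)
    (CycProduct.polyMap : MvPolynomial (Fin 2) ℤ →+* CycProduct)
    (CompletedGroupAlgebra.denseRange_polyMap ha) CycProduct.denseRange_polyMap
    (CompletedGroupAlgebra.tendsto_polyMap a) (CycProduct.tendsto_polyMap hA ha)
  refine ⟨Φ, h, fun i => ?_⟩
  rw [← CompletedGroupAlgebra.polyMap_X, hΦ]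
  exact MvPolynomial.aeval_X _ i

end MainIsomorphism

/-! ### Unramified algebras over the `p`-adic integers -/

/-- A finite torsion-free `ℤ_p`-algebra is unramified when some iterate of the Frobenius map is the
identity modulo `p`. -/
structure IsPadicUnramified (p : ℕ) [Fact p.Prime] (B : Type*) [CommRing B] [Algebra ℤ_[p] B] :
    Prop where
  finite : Module.Finite ℤ_[p] B
  torsionFree : Module.IsTorsionFree ℤ_[p] B
  frobenius : ∃ k : ℕ, k ≠ 0 ∧ ∀ a : B, (p : B) ∣ a ^ p ^ k - a

/-- A nonzero unramified `ℤ_p`-algebra in which every element is a unit or divisible by `p`. -/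
structure IsPadicUnramifiedLocal (p : ℕ) [Fact p.Prime] (B : Type*) [CommRing B]
    [Algebra ℤ_[p] B] : Prop extends IsPadicUnramified p B where
  nontrivial : Nontrivial B
  isUnit_or_dvd : ∀ a : B, IsUnit a ∨ (p : B) ∣ a

variable {p : ℕ} [hpp : Fact p.Prime]

theorem PadicInt.dvd_pow_sub_self (z : ℤ_[p]) (k : ℕ) : (p : ℤ_[p]) ∣ z ^ p ^ k - z := by
  rw [← Ideal.mem_span_singleton, ← PadicInt.maximalIdeal_eq_span_p, ← PadicInt.ker_toZMod,
    RingHom.mem_ker, map_sub, map_pow, ZMod.pow_card_pow, sub_self]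

theorem dvd_add_pow_prime_pow_sub {B : Type*} [CommRing B] {x y : B} {k : ℕ}
    (hx : (p : B) ∣ x ^ p ^ k - x) (hy : (p : B) ∣ y ^ p ^ k - y) :
    (p : B) ∣ (x + y) ^ p ^ k - (x + y) := by
  obtain ⟨r, hr⟩ := exists_add_pow_prime_pow_eq hpp.out x y k
  have : (x + y) ^ p ^ k - (x + y) = (x ^ p ^ k - x) + (y ^ p ^ k - y) + p * (x * y * r) := by
    rw [hr]; ring
  rw [this]
  exact dvd_add (dvd_add hx hy) (dvd_mul_right _ _)

theorem dvd_mul_pow_sub {B : Type*} [CommRing B] {q x y : B} {k : ℕ}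
    (hx : q ∣ x ^ k - x) (hy : q ∣ y ^ k - y) : q ∣ (x * y) ^ k - x * y := by
  have : (x * y) ^ k - x * y = (x ^ k - x) * y ^ k + x * (y ^ k - y) := by ring
  rw [this]
  exact dvd_add (hx.mul_right _) (hy.mul_left _)

theorem CycTensor.isPadicUnramified (f : Cyc p × Cyc p) : IsPadicUnramified p (CycTensor f) := by
  obtain ⟨m, hm1, hmp, hm⟩ := exists_root_pow_eq_one f
  refine ⟨inferInstance, inferInstance, m.totient, (Nat.totient_pos.2 hm1).ne', fun a => ?_⟩
  have ha : a ∈ Algebra.adjoin ℤ_[p] (Set.range (root f)) := adjoin_range_root f ▸ Algebra.mem_top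
  induction ha using Algebra.adjoin_induction with
  | mem x hx =>
    obtain ⟨j, rfl⟩ := hx
    have : root f j ^ p ^ m.totient = root f j ^ 1 :=
      pow_eq_pow_of_modEq (Nat.ModEq.pow_totient hmp.symm) (hm j)
    rw [this, pow_one, sub_self]
    exact dvd_zero _
  | algebraMap z =>
    have := map_dvd (algebraMap ℤ_[p] (CycTensor f)) (PadicInt.dvd_pow_sub_self z m.totient)
    simpa using this
  | add x y _ _ hx hy => exact dvd_add_pow_prime_pow_sub hx hy
  | mul x y _ _ hx hy => exact dvd_mul_pow_sub hx hy

namespace IsPadicUnramified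

variable {B : Type*} [CommRing B] [Algebra ℤ_[p] B]

theorem free (h : IsPadicUnramified p B) : Module.Free ℤ_[p] B :=
  have := h.finite
  have := h.torsionFree
  Module.free_of_finite_type_torsion_free'

theorem eq_zero_of_forall_dvd (h : IsPadicUnramified p B) {x : B} (hx : ∀ n : ℕ, (p : B) ^ n ∣ x) :
    x = 0 := by
  have := h.finite
  have := h.free
  let _ : TopologicalSpace B := moduleTopology ℤ_[p] B
  have : IsModuleTopology ℤ_[p] B := ⟨rfl⟩
  have := PadicInt.finite_moduleTopology_t2Space p B
  by_contra hne
  obtain ⟨k, hk⟩ := PadicInt.exists_pow_mul_subset p B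
    (isOpen_compl_singleton.mem_nhds (show (0 : B) ∈ ({x}ᶜ : Set B) from fun h => hne h.symm))
  obtain ⟨b, hb⟩ := hx k
  exact hk ⟨b, rfl⟩ hb.symm

theorem eq_zero_of_natCast_mul_eq_zero (h : IsPadicUnramified p B) {x : B} (hx : (p : B) * x = 0) :
    x = 0 := by
  have := h.torsionFree
  have h1 : (p : ℤ_[p]) • x = 0 := by rw [Algebra.smul_def, map_natCast, hx]
  exact (smul_eq_zero_iff_right (Nat.cast_ne_zero.2 hpp.out.ne_zero)).1 h1

/-- Teichmüller representatives, as limits of the sequences `a ^ Q ^ n` with `Q` the order of a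
Frobenius power that is trivial modulo `p`. -/
theorem exists_teichmuller (h : IsPadicUnramified p B) :
    ∃ Q : ℕ, 2 ≤ Q ∧ (Q - 1).Coprime p ∧ ∀ a : B, ∃ τ : B, τ ^ Q = τ ∧ (p : B) ∣ τ - a := by
  have := h.finite
  have := h.free
  obtain ⟨k, hk0, hk⟩ := h.frobenius
  let _ : TopologicalSpace B := moduleTopology ℤ_[p] B
  have : IsModuleTopology ℤ_[p] B := ⟨rfl⟩
  have := PadicInt.finite_moduleTopology_t2Space p B
  have := PadicInt.finite_moduleTopology_compactSpace p B
  have := PadicInt.finite_moduleTopology_isTopologicalRing p B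
  have hQ : 2 ≤ p ^ k := hpp.out.two_le.trans (Nat.le_self_pow hk0 p)
  refine ⟨p ^ k, hQ, ?_, fun a => ?_⟩
  · refine ((Nat.Prime.coprime_iff_not_dvd hpp.out).2 fun hd => ?_).symm
    have h1 : p ∣ 1 := by
      have := Nat.dvd_sub (dvd_pow_self p hk0) hd
      rwa [Nat.sub_sub_self (by omega)] at this
    exact hpp.out.one_lt.ne' (Nat.dvd_one.1 h1)
  have hpow : ∀ {x y : B} {n : ℕ}, (p : B) ^ (n + 1) ∣ x - y →
      (p : B) ^ (n + 2) ∣ x ^ p ^ k - y ^ p ^ k := by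
    intro x y n hxy
    obtain ⟨l, rfl⟩ := Nat.exists_eq_succ_of_ne_zero hk0
    rw [Nat.succ_eq_add_one, pow_succ' p, pow_mul, pow_mul]
    have h1 : (p : B) ^ (n + 2) ∣ x ^ p - y ^ p := by
      rw [← (Commute.all x y).geom_sum₂_mul, pow_succ']
      exact mul_dvd_mul (dvd_geom_sum₂_self ((dvd_pow_self _ (Nat.succ_ne_zero n)).trans hxy)) hxy
    exact h1.trans (sub_dvd_pow_sub_pow _ _ _)
  have hseq : ∀ n, (p : B) ^ (n + 1) ∣ a ^ (p ^ k) ^ (n + 1) - a ^ (p ^ k) ^ n := by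
    intro n
    induction n with
    | zero => simpa using hk a
    | succ n ih =>
      have := hpow ih
      rwa [← pow_mul a, ← pow_mul a, ← pow_succ, ← pow_succ] at this
  let V : ℕ → Set B := fun n => {x | (p : B) ^ (n + 1) ∣ x - a ^ (p ^ k) ^ n}
  have hVc : ∀ n, IsClosed (V n) := fun n => by
    have : V n = (fun b => (p : B) ^ (n + 1) * b + a ^ (p ^ k) ^ n) '' Set.univ := by
      ext x
      simp only [V, Set.mem_ofPred_eq, Set.image_univ, Set.mem_range, dvd_def]
      exact exists_congr fun c => ⟨fun hc => by rw [← hc]; ring, fun hc => by rw [← hc]; ring⟩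
    rw [this]
    exact (isCompact_univ.image (by fun_prop)).isClosed
  obtain ⟨τ, hτ⟩ := IsCompact.nonempty_iInter_of_sequence_nonempty_isCompact_isClosed V
    (fun n x hx => by
      have h1 : (p : B) ^ (n + 1) ∣ x - a ^ (p ^ k) ^ (n + 1) :=
        (pow_dvd_pow _ (Nat.le_succ _)).trans hx
      have := dvd_add h1 (hseq n)
      rwa [sub_add_sub_cancel] at this)
    (fun n => ⟨a ^ (p ^ k) ^ n, by simp [V]⟩) (hVc 0).isCompact hVc
  rw [Set.mem_iInter] at hτ
  refine ⟨τ, ?_, by simpa [V] using hτ 0⟩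
  rw [← sub_eq_zero]
  refine h.eq_zero_of_forall_dvd fun n => ?_
  have h1 : (p : B) ^ (n + 1) ∣ τ ^ p ^ k - a ^ (p ^ k) ^ (n + 1) := by
    have := hpow (hτ n)
    rw [← pow_mul a, ← pow_succ] at this
    exact (pow_dvd_pow _ (Nat.le_succ _)).trans this
  have h2 : (p : B) ^ (n + 1) ∣ τ - a ^ (p ^ k) ^ (n + 1) :=
    (pow_dvd_pow _ (Nat.le_succ _)).trans (hτ (n + 1))
  have := dvd_sub h1 h2
  rw [sub_sub_sub_cancel_right] at this
  exact (pow_dvd_pow _ (Nat.le_succ _)).trans this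

/-- The geometric series for the inverse converges. -/
theorem isUnit_one_add_mul (h : IsPadicUnramified p B) (c : B) : IsUnit (1 + (p : B) * c) := by
  have := h.finite
  have := h.free
  let _ : TopologicalSpace B := moduleTopology ℤ_[p] B
  have : IsModuleTopology ℤ_[p] B := ⟨rfl⟩
  have := PadicInt.finite_moduleTopology_t2Space p B
  have := PadicInt.finite_moduleTopology_compactSpace p B
  have := PadicInt.finite_moduleTopology_isTopologicalRing p B
  have := PadicInt.finite_moduleTopology_isLinearTopology p B
  have hcl : IsClosed (Set.range fun b => (1 + (p : B) * c) * b) :=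
    (isCompact_range (by fun_prop)).isClosed
  have hnil : Tendsto (fun n : ℕ => ((p : B) * c) ^ n) atTop (𝓝 0) :=
    (PadicInt.isTopologicallyNilpotent_natCast p B).mul_right c
  have ht : Tendsto (fun n : ℕ => 1 - (-((p : B) * c)) ^ n) atTop (𝓝 1) := by
    have h1 : Tendsto (fun n : ℕ => (-1) ^ n * ((p : B) * c) ^ n) atTop (𝓝 0) :=
      IsLinearTopology.tendsto_mul_zero_of_right _ _ hnil
    have h2 := (tendsto_const_nhds (x := (1 : B))).sub h1
    simp only [sub_zero] at h2
    refine h2.congr fun n => ?_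
    rw [neg_pow ((p : B) * c)]
  obtain ⟨b, hb⟩ := hcl.mem_of_tendsto ht (Eventually.of_forall fun n =>
    ⟨∑ i ∈ Finset.range n, (-((p : B) * c)) ^ i, by
      have := mul_neg_geom_sum (-((p : B) * c)) n
      rwa [sub_neg_eq_add] at this⟩)
  exact IsUnit.of_mul_eq_one _ hb

/-- The Teichmüller representative `τ` of an element satisfies `τ ^ Q = τ`, so that `τ ^ (Q - 1)`
is idempotent. If it is `0`, the element is divisible by `p`, and if it is `1`, the element is a
unit. -/
theorem local_of_idempotent [Nontrivial B] (h : IsPadicUnramified p B)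
    (hB : ∀ e : B, IsIdempotentElem e → e = 0 ∨ e = 1) : IsPadicUnramifiedLocal p B := by
  refine { h with nontrivial := inferInstance, isUnit_or_dvd := fun a => ?_ }
  obtain ⟨Q, hQ, -, hT⟩ := h.exists_teichmuller
  obtain ⟨τ, hτ, hd⟩ := hT a
  obtain ⟨n, rfl⟩ : ∃ n, Q = n + 2 := ⟨Q - 2, by omega⟩
  have he : IsIdempotentElem (τ ^ (n + 1)) := by
    change τ ^ (n + 1) * τ ^ (n + 1) = τ ^ (n + 1)
    calc τ ^ (n + 1) * τ ^ (n + 1) = τ ^ (n + 2) * τ ^ n := by ring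
      _ = τ ^ (n + 1) := by rw [hτ]; ring
  rcases hB _ he with h0 | h1
  · right
    have : τ = 0 := by rw [← hτ, pow_succ, h0, zero_mul]
    rw [this, zero_sub, dvd_neg] at hd
    exact hd
  · left
    have hu : IsUnit τ := IsUnit.of_pow_eq_one h1 (by omega)
    obtain ⟨c, hc⟩ := hd
    obtain ⟨u, rfl⟩ := hu
    have : a = u * (1 + (p : B) * (-(↑u⁻¹ * c))) := by
      have h2 : (u : B) * ↑u⁻¹ = 1 := u.mul_inv
      linear_combination hc * (-1) + (p : B) * c * h2
    rw [this]
    exact u.isUnit.mul (h.isUnit_one_add_mul _)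

theorem of_quotient (h : IsPadicUnramified p B) {e : B} (he : IsIdempotentElem e) :
    IsPadicUnramified p (B ⧸ Ideal.span {e}) := by
  have := h.finite
  have := h.torsionFree
  obtain ⟨k, hk0, hk⟩ := h.frobenius
  refine ⟨inferInstance, ?_, k, hk0, fun a => ?_⟩
  · refine Module.IsTorsionFree.of_smul_eq_zero fun c x hcx => ?_
    obtain ⟨x, rfl⟩ := Ideal.Quotient.mk_surjective x
    by_contra! hne
    have h1 : c • x ∈ Ideal.span {e} := by
      rw [← Ideal.Quotient.eq_zero_iff_mem, ← hcx]
      rfl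
    obtain ⟨y, hy⟩ := Ideal.mem_span_singleton.1 h1
    have h2 : c • (x * (1 - e)) = 0 := by
      rw [← smul_mul_assoc, hy]
      have : e * e = e := he
      linear_combination -y * this
    have h3 := (smul_eq_zero_iff_right hne.1).1 h2
    refine hne.2 (Ideal.Quotient.eq_zero_iff_mem.2 (Ideal.mem_span_singleton.2 ⟨x, ?_⟩))
    linear_combination h3
  · obtain ⟨a, rfl⟩ := Ideal.Quotient.mk_surjective a
    have := map_dvd (Ideal.Quotient.mk (Ideal.span {e})) (hk a)
    simpa using this

end IsPadicUnramified

namespace IsPadicUnramifiedLocal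

variable {B : Type*} [CommRing B] [Algebra ℤ_[p] B]

theorem of_algEquiv (h : IsPadicUnramifiedLocal p B) {B' : Type*} [CommRing B'] [Algebra ℤ_[p] B']
    (e : B ≃ₐ[ℤ_[p]] B') : IsPadicUnramifiedLocal p B' := by
  have := h.finite
  have := h.torsionFree
  have := h.nontrivial
  obtain ⟨k, hk0, hk⟩ := h.frobenius
  have hd : ∀ {a : B}, (p : B) ∣ a → (p : B') ∣ e a := fun hx => by
    simpa using map_dvd e hx
  refine ⟨⟨Module.Finite.equiv e.toLinearEquiv, ?_, k, hk0, fun a => ?_⟩, e.injective.nontrivial,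
    fun a => ?_⟩
  · exact e.symm.toLinearEquiv.injective.moduleIsTorsionFree _ (fun c x => map_smul e.symm c x)
  · have := hd (hk (e.symm a))
    simpa using this
  · obtain ⟨a, rfl⟩ := e.surjective a
    exact (h.isUnit_or_dvd a).imp (fun hu => hu.map e) hd

theorem not_isUnit (h : IsPadicUnramifiedLocal p B) : ¬ IsUnit (p : B) := fun hu => by
  have := h.nontrivial
  exact one_ne_zero (h.eq_zero_of_forall_dvd fun n => (hu.pow n).dvd)

theorem not_isUnit_iff_dvd (h : IsPadicUnramifiedLocal p B) {a : B} : ¬ IsUnit a ↔ (p : B) ∣ a :=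
  ⟨fun ha => (h.isUnit_or_dvd a).resolve_left ha,
    fun hd hu => h.not_isUnit (isUnit_of_dvd_unit hd hu)⟩

theorem isLocalRing (h : IsPadicUnramifiedLocal p B) : IsLocalRing B :=
  have := h.nontrivial
  IsLocalRing.of_nonunits_add fun a b ha hb => by
    rw [mem_nonunits_iff, h.not_isUnit_iff_dvd] at *
    exact dvd_add ha hb

theorem maximalIdeal_eq (h : IsPadicUnramifiedLocal p B) [IsLocalRing B] :
    IsLocalRing.maximalIdeal B = Ideal.span {(p : B)} := by
  ext a
  rw [IsLocalRing.mem_maximalIdeal, mem_nonunits_iff, h.not_isUnit_iff_dvd,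
    Ideal.mem_span_singleton]

theorem exists_eq_pow_mul (h : IsPadicUnramifiedLocal p B) {x : B} (hx : x ≠ 0) :
    ∃ (n : ℕ) (u : Bˣ), x = (p : B) ^ n * u := by
  have : ∃ n : ℕ, ¬ (p : B) ^ n ∣ x := by
    by_contra! hall
    exact hx (h.eq_zero_of_forall_dvd hall)
  classical
  let n := Nat.find this
  have hn : ¬ (p : B) ^ n ∣ x := Nat.find_spec this
  have hn0 : n ≠ 0 := fun h0 => hn (by rw [h0, pow_zero]; exact one_dvd _)
  obtain ⟨y, hy⟩ : (p : B) ^ (n - 1) ∣ x := not_not.1 (Nat.find_min this (by omega : n - 1 < n))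
  have hyu : IsUnit y := by
    by_contra hyu
    obtain ⟨z, rfl⟩ := h.not_isUnit_iff_dvd.1 hyu
    refine hn ⟨z, ?_⟩
    rw [hy, ← mul_assoc, pow_sub_one_mul hn0]
  exact ⟨n - 1, hyu.unit, hy⟩

theorem isDomain (h : IsPadicUnramifiedLocal p B) : IsDomain B := by
  have := h.nontrivial
  have hp : ∀ (n : ℕ) (x : B), (p : B) ^ n * x = 0 → x = 0 := by
    intro n
    induction n with
    | zero => intro x hx; simpa using hx
    | succ n ih =>
      intro x hx
      exact ih x (h.eq_zero_of_natCast_mul_eq_zero (by rw [← mul_assoc, ← pow_succ', hx]))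
  have : NoZeroDivisors B := ⟨fun {a b} hab => by
    by_contra! hne
    obtain ⟨n, u, rfl⟩ := h.exists_eq_pow_mul hne.1
    rw [mul_assoc] at hab
    have := hp _ _ hab
    rw [Units.mul_right_eq_zero] at this
    exact hne.2 this⟩
  exact NoZeroDivisors.to_isDomain B

theorem isDiscreteValuationRing (h : IsPadicUnramifiedLocal p B) [IsDomain B] :
    IsDiscreteValuationRing B := by
  have := h.finite
  have := h.isLocalRing
  have : IsNoetherianRing B := IsNoetherianRing.of_finite ℤ_[p] B
  have hp0 : (p : B) ≠ 0 := fun h0 => by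
    have := h.eq_zero_of_natCast_mul_eq_zero (x := 1) (by rw [h0, zero_mul])
    exact one_ne_zero this
  refine ((IsDiscreteValuationRing.TFAE B fun hf => ?_).out 0 4).2 ?_
  · obtain ⟨b, hb⟩ := hf.mul_inv_cancel hp0
    exact h.not_isUnit (IsUnit.of_mul_eq_one _ hb)
  · rw [h.maximalIdeal_eq]
    exact ⟨⟨_, rfl⟩⟩

end IsPadicUnramifiedLocal

/-! ### Unramified algebras are products of rings of integers -/

namespace IsPadicUnramifiedLocal

variable {B : Type*} [CommRing B] [Algebra ℤ_[p] B]

theorem _root_.PadicInt.isUnit_natCast_algebra {m : ℕ} (hm : m.Coprime p) :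
    IsUnit (m : B) := by
  have := (PadicInt.isUnit_natCast_of_coprime hm).map (algebraMap ℤ_[p] B)
  rwa [map_natCast] at this

/-- Roots of unity of order prime to `p` are determined by their residue classes: if `u ^ m = 1`
and `u ≡ 1`, then the cofactor `1 + u + ⋯ + u ^ (m - 1)` of `u - 1` is `≡ m`, hence a unit. -/
theorem eq_one_of_pow_eq_one (h : IsPadicUnramifiedLocal p B) {u : B} {m : ℕ} (hm : m.Coprime p)
    (hu : u ^ m = 1) (hd : (p : B) ∣ u - 1) : u = 1 := by
  have := h.isDomain
  have h0 : (∑ i ∈ Finset.range m, u ^ i) * (u - 1) = 0 := by rw [geom_sum_mul, hu, sub_self]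
  rcases mul_eq_zero.1 h0 with h1 | h1
  · exfalso
    have h2 : (p : B) ∣ (∑ i ∈ Finset.range m, u ^ i) - m := by
      have : (∑ i ∈ Finset.range m, u ^ i) - (m : B) = ∑ i ∈ Finset.range m, (u ^ i - 1) := by
        simp
      rw [this]
      refine Finset.dvd_sum fun i _ => hd.trans ?_
      simpa using sub_dvd_pow_sub_pow u 1 i
    rw [h1, zero_sub, dvd_neg] at h2
    exact h.not_isUnit_iff_dvd.2 h2 (PadicInt.isUnit_natCast_algebra hm)
  · exact sub_eq_zero.1 h1

theorem natCast_ne_zero (h : IsPadicUnramifiedLocal p B) : (p : B) ≠ 0 := fun h0 => by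
  have := h.nontrivial
  exact one_ne_zero (h.eq_zero_of_natCast_mul_eq_zero (x := 1) (by rw [h0, zero_mul]))

theorem finite_residueField (h : IsPadicUnramifiedLocal p B) [IsLocalRing B] :
    Finite (IsLocalRing.ResidueField B) := by
  have := h.finite
  let _ : TopologicalSpace B := moduleTopology ℤ_[p] B
  have : IsModuleTopology ℤ_[p] B := ⟨rfl⟩
  have := PadicInt.finite_moduleTopology_compactSpace p B
  have := PadicInt.finite_moduleTopology_isTopologicalRing p B
  refine Ideal.finite_quotient_of_isOpen (J := IsLocalRing.maximalIdeal B) ?_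
  rw [h.maximalIdeal_eq]
  convert PadicInt.isOpen_range_pow_mul p B 1 using 1
  ext x
  simp [Ideal.mem_span_singleton, dvd_def, eq_comm]

theorem residue_eq_zero_iff (h : IsPadicUnramifiedLocal p B) [IsLocalRing B] {x : B} :
    IsLocalRing.residue B x = 0 ↔ (p : B) ∣ x := by
  rw [IsLocalRing.residue_eq_zero_iff, h.maximalIdeal_eq, Ideal.mem_span_singleton]

theorem charP_residueField (h : IsPadicUnramifiedLocal p B) [IsLocalRing B] :
    CharP (IsLocalRing.ResidueField B) p := by
  rw [CharP.charP_iff_prime_eq_zero hpp.out, ← map_natCast (IsLocalRing.residue B),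
    h.residue_eq_zero_iff]

/-- Nakayama's lemma for subalgebras: generators modulo `p` are generators. -/
theorem _root_.Subalgebra.eq_top_of_forall_dvd_sub [Module.Finite ℤ_[p] B] (S : Subalgebra ℤ_[p] B)
    (hS : ∀ x : B, ∃ s ∈ S, (p : B) ∣ x - s) : S = ⊤ := by
  rw [← Algebra.toSubmodule_eq_top, eq_top_iff]
  refine Submodule.le_of_le_smul_of_le_jacobson_bot (I := IsLocalRing.maximalIdeal ℤ_[p])
    Module.Finite.fg_top (IsLocalRing.maximalIdeal_le_jacobson _) fun x _ => ?_
  obtain ⟨s, hs, b, hb⟩ := hS x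
  rw [← sub_add_cancel x s, add_comm]
  refine Submodule.add_mem_sup hs ?_
  have : x - s = (p : ℤ_[p]) • b := by rw [hb, Algebra.smul_def, map_natCast]
  rw [this]
  exact Submodule.smul_mem_smul (by
    rw [PadicInt.maximalIdeal_eq_span_p]; exact Ideal.mem_span_singleton_self _) trivial

/-- The Teichmüller lift of a generator of the multiplicative group of the residue field. -/
theorem exists_isPrimitiveRoot_adjoin_eq_top (h : IsPadicUnramifiedLocal p B) :
    ∃ r : ℕ, 1 ≤ r ∧ ∃ τ : B, IsPrimitiveRoot τ (p ^ r - 1) ∧ Algebra.adjoin ℤ_[p] {τ} = ⊤ := by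
  have := h.isLocalRing
  have := h.finite
  have := h.finite_residueField
  have := h.charP_residueField
  let _ := Fintype.ofFinite (IsLocalRing.ResidueField B)
  obtain ⟨r, -, hr⟩ := FiniteField.card (IsLocalRing.ResidueField B) p
  obtain ⟨g, hg⟩ := IsCyclic.exists_generator (α := (IsLocalRing.ResidueField B)ˣ)
  obtain ⟨a, ha⟩ := IsLocalRing.residue_surjective (g : IsLocalRing.ResidueField B)
  obtain ⟨Q, hQ, hQp, hT⟩ := h.exists_teichmuller
  obtain ⟨τ, hτ, hd⟩ := hT a
  have hgτ : IsLocalRing.residue B τ = g := by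
    rw [← ha, ← sub_eq_zero, ← map_sub, h.residue_eq_zero_iff]; exact hd
  have hτu : IsUnit τ := by
    rw [← IsLocalRing.residue_ne_zero_iff_isUnit, hgτ]; exact g.ne_zero
  have hτ1 : τ ^ (Q - 1) = 1 := by
    refine hτu.mul_right_cancel ?_
    rw [← pow_succ, Nat.sub_add_cancel (by omega), hτ, one_mul]
  have hcard : Nat.card (IsLocalRing.ResidueField B)ˣ = p ^ (r : ℕ) - 1 := by
    rw [Nat.card_units, Nat.card_eq_fintype_card, hr]
  have hord : orderOf g = p ^ (r : ℕ) - 1 := by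
    rw [← hcard]; exact orderOf_eq_card_of_forall_mem_zpowers hg
  refine ⟨r, r.pos, τ, ⟨?_, fun l hl => ?_⟩, ?_⟩
  · refine h.eq_one_of_pow_eq_one (m := Q - 1) hQp
      (by rw [← pow_mul, mul_comm, pow_mul, hτ1, one_pow]) ?_
    rw [← h.residue_eq_zero_iff, map_sub, map_pow, hgτ, map_one, ← Units.val_pow_eq_pow_val, ← hord,
      pow_orderOf_eq_one, Units.val_one, sub_self]
  · rw [← hord]
    refine orderOf_dvd_of_pow_eq_one (Units.ext ?_)
    rw [Units.val_pow_eq_pow_val, ← hgτ, ← map_pow, hl, map_one, Units.val_one]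
  · refine Subalgebra.eq_top_of_forall_dvd_sub _ fun x => ?_
    by_cases hx : IsLocalRing.residue B x = 0
    · exact ⟨0, zero_mem _, by rw [sub_zero]; exact h.residue_eq_zero_iff.1 hx⟩
    · obtain ⟨l, hl⟩ := mem_powers_iff_mem_zpowers.2 (hg (Units.mk0 _ hx))
      refine ⟨τ ^ l, pow_mem (Algebra.self_mem_adjoin_singleton ℤ_[p] τ) l, ?_⟩
      rw [← h.residue_eq_zero_iff, map_sub, map_pow, hgτ, ← Units.val_pow_eq_pow_val]
      have : g ^ l = Units.mk0 _ hx := hl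
      rw [this, Units.val_mk0, sub_self]

end IsPadicUnramifiedLocal

/-- A nonzero local unramified `ℤ_p`-algebra is the integral closure of `ℤ_p` in its fraction field,
which is a cyclotomic extension of `ℚ_p`. -/
theorem IsPadicUnramifiedLocal.exists_algEquiv_zq {D : Type} [CommRing D] [Algebra ℤ_[p] D]
    (h : IsPadicUnramifiedLocal p D) : ∃ r : ℕ, 1 ≤ r ∧ Nonempty (D ≃ₐ[ℤ_[p]] Zq p r) := by
  obtain ⟨r, hr, τ, hτ, htop⟩ := h.exists_isPrimitiveRoot_adjoin_eq_top
  refine ⟨r, hr, ?_⟩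
  have := h.finite
  have := h.torsionFree
  have := h.isDomain
  have := h.isDiscreteValuationRing
  let K := FractionRing D
  have hinj : Function.Injective (algebraMap ℤ_[p] K) := by
    rw [IsScalarTower.algebraMap_eq ℤ_[p] D K]
    exact (IsFractionRing.injective D K).comp (FaithfulSMul.algebraMap_injective ℤ_[p] D)
  let _ : Algebra ℚ_[p] K := (IsFractionRing.lift (K := ℚ_[p]) hinj).toAlgebra
  have : IsScalarTower ℤ_[p] ℚ_[p] K :=
    IsScalarTower.of_algebraMap_eq fun x => (IsFractionRing.lift_algebraMap hinj x).symm
  have hn0 : p ^ r - 1 ≠ 0 := by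
    have := Nat.one_lt_pow (by omega : r ≠ 0) hpp.out.one_lt
    omega
  have : NeZero (p ^ r - 1) := ⟨hn0⟩
  -- `D` is generated by `τ`, and every element of `K` is a quotient of one of `D` by a power of `p`
  have hle : ∀ d : D, algebraMap D K d ∈ Algebra.adjoin ℚ_[p] {b : K | b ^ (p ^ r - 1) = 1} := by
    intro d
    have hd : d ∈ Algebra.adjoin ℤ_[p] {τ} := htop ▸ Algebra.mem_top
    induction hd using Algebra.adjoin_induction with
    | mem x hx =>
      rw [Set.mem_singleton_iff.1 hx]
      refine Algebra.subset_adjoin ?_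
      change _ ^ _ = _
      rw [← map_pow, hτ.pow_eq_one, map_one]
    | algebraMap z =>
      rw [← IsScalarTower.algebraMap_apply, IsScalarTower.algebraMap_apply ℤ_[p] ℚ_[p] K]
      exact Subalgebra.algebraMap_mem _ _
    | add x y _ _ hx hy => rw [map_add]; exact add_mem hx hy
    | mul x y _ _ hx hy => rw [map_mul]; exact mul_mem hx hy
  have hcyc : IsCyclotomicExtension {p ^ r - 1} ℚ_[p] K := by
    refine (IsCyclotomicExtension.iff_singleton _ _ _).2
      ⟨⟨algebraMap D K τ, hτ.map_of_injective (IsFractionRing.injective D K)⟩, fun x => ?_⟩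
    obtain ⟨d, s, hs, rfl⟩ := IsFractionRing.div_surjective (A := D) x
    obtain ⟨n, v, rfl⟩ := h.exists_eq_pow_mul (nonZeroDivisors.ne_zero hs)
    have hp0 : (p : K) ≠ 0 := by
      rw [← map_natCast (algebraMap D K)]
      exact (map_ne_zero_iff _ (IsFractionRing.injective D K)).2 h.natCast_ne_zero
    have hv : algebraMap D K ↑v * algebraMap D K ↑v⁻¹ = 1 := by
      rw [← map_mul, v.mul_inv, map_one]
    have : algebraMap D K d / algebraMap D K (p ^ n * v) =
        algebraMap ℚ_[p] K ((p : ℚ_[p]) ^ n)⁻¹ * algebraMap D K (d * ↑v⁻¹) := by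
      have hv0 := left_ne_zero_of_mul_eq_one hv
      rw [map_inv₀, map_pow, map_mul, map_mul, map_pow, map_natCast, map_natCast]
      rw [div_eq_iff (mul_ne_zero (pow_ne_zero _ hp0) hv0)]
      have := inv_mul_cancel₀ (pow_ne_zero n hp0)
      linear_combination -(algebraMap D K d) * hv -
        (algebraMap D K d) * (algebraMap D K ↑v * algebraMap D K ↑v⁻¹) * this
    rw [this]
    exact mul_mem (Subalgebra.algebraMap_mem _ _) (hle _)
  have : IsIntegralClosure D ℤ_[p] K := IsIntegralClosure.of_isIntegrallyClosedIn
  let ε : K ≃ₐ[ℚ_[p]] CyclotomicField (p ^ r - 1) ℚ_[p] :=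
    IsCyclotomicExtension.algEquiv {p ^ r - 1} ℚ_[p] K _
  exact ⟨(IsIntegralClosure.equiv ℤ_[p] D K (integralClosure ℤ_[p] K)).trans
    (ε.restrictScalars ℤ_[p]).mapIntegralClosure⟩

/-- Nontrivial idempotents split an algebra into two of smaller rank. -/
theorem IsPadicUnramified.exists_algEquiv_pi_fintype {B : Type} [CommRing B] [Algebra ℤ_[p] B]
    (h : IsPadicUnramified p B) : ∃ (ι : Type) (_ : Fintype ι) (r : ι → ℕ)
      (_ : B ≃ₐ[ℤ_[p]] ∀ k, Zq p (r k)),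
      ∀ k, 1 ≤ r k ∧ IsPadicUnramifiedLocal p (Zq p (r k)) := by
  have hfin := h.finite
  obtain ⟨N, hN⟩ : ∃ N, Module.finrank ℤ_[p] B = N := ⟨_, rfl⟩
  induction N using Nat.strong_induction_on generalizing B with
  | _ N ih =>
  subst hN
  rcases subsingleton_or_nontrivial B with hB | hB
  · refine ⟨Empty, inferInstance, fun _ => 0, ?_, fun k => k.elim⟩
    exact AlgEquiv.ofBijective (AlgHom.pi fun k => k.elim)
      ⟨fun _ _ _ => Subsingleton.elim _ _, fun y => ⟨0, funext fun k => k.elim⟩⟩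
  · by_cases hid : ∀ e : B, IsIdempotentElem e → e = 0 ∨ e = 1
    · have hl := h.local_of_idempotent hid
      obtain ⟨r, hr, ⟨e⟩⟩ := hl.exists_algEquiv_zq
      exact ⟨Unit, inferInstance, fun _ => r, e.trans (AlgEquiv.funUnique ℤ_[p] Unit _).symm,
        fun _ => ⟨hr, hl.of_algEquiv e⟩⟩
    · push Not at hid
      obtain ⟨e, he, he0, he1⟩ := hid
      have key : ∀ f g : B, IsIdempotentElem f → IsIdempotentElem g → f + g = 1 → f * g = 0 →
          f ≠ 0 → Module.finrank ℤ_[p] (B ⧸ Ideal.span {f}) < Module.finrank ℤ_[p] B := by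
        intro f g hf hg hfg1 hfg hf0
        have h1 := h.of_quotient hf
        have h2 := h.of_quotient hg
        have := h1.finite
        have := h2.finite
        have := h1.free
        have := h2.free
        have : Nontrivial (B ⧸ Ideal.span {g}) := by
          rw [Ideal.Quotient.nontrivial_iff, Ne, Ideal.span_singleton_eq_top]
          intro hu
          exact hf0 (hu.mul_left_eq_zero.1 hfg)
        rw [(AlgEquiv.prodQuotientOfIsIdempotentElem ℤ_[p] hf hg hfg1 hfg).toLinearEquiv.finrank_eq,
          Module.finrank_prod]
        exact Nat.lt_add_of_pos_right Module.finrank_pos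
      have h1 : e + (1 - e) = 1 := by ring
      have h2 : e * (1 - e) = 0 := by rw [mul_sub, mul_one, he.eq, sub_self]
      obtain ⟨ι, _, r, ε, hε⟩ := ih _ (key e _ he he.one_sub h1 h2 he0) (h.of_quotient he)
        inferInstance rfl
      obtain ⟨ι', _, r', ε', hε'⟩ := ih _ (key _ e he.one_sub he (by rw [add_comm, h1])
        (by rw [mul_comm, h2]) (sub_ne_zero.2 he1.symm)) (h.of_quotient he.one_sub)
        inferInstance rfl
      refine ⟨ι ⊕ ι', inferInstance, Sum.elim r r',
        (AlgEquiv.prodQuotientOfIsIdempotentElem ℤ_[p] he he.one_sub h1 h2).trans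
          ((AlgEquiv.prodCongr ε ε').trans (AlgEquiv.ofLinearEquiv
            (LinearEquiv.sumPiEquivProdPi ℤ_[p] ι ι' fun k => Zq p (Sum.elim r r' k)).symm ?_ ?_)),
        ?_⟩
      · funext k; rcases k with k | k <;> rfl
      · intro x y; funext k; rcases k with k | k <;> rfl
      · rintro (k | k)
        exacts [hε k, hε' k]

/-- An unramified `ℤ_p`-algebra is a finite product of rings of integers of unramified
extensions of `ℚ_p`. -/
theorem IsPadicUnramified.exists_algEquiv_pi {B : Type} [CommRing B] [Algebra ℤ_[p] B]
    (h : IsPadicUnramified p B) : ∃ (n : ℕ) (r : Fin n → ℕ) (_ : B ≃ₐ[ℤ_[p]] ∀ k, Zq p (r k)),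
      ∀ k, 1 ≤ r k ∧ IsPadicUnramifiedLocal p (Zq p (r k)) := by
  obtain ⟨ι, _, r, e, he⟩ := h.exists_algEquiv_pi_fintype
  let σ := Fintype.equivFin ι
  exact ⟨Fintype.card ι, fun k => r (σ.symm k),
    e.trans (AlgEquiv.piCongrLeft' ℤ_[p] (fun k => Zq p (r k)) σ), fun k => he _⟩

/-! ### Power series over complete regular local rings -/

/-- A compact Hausdorff Noetherian local ring is complete: the powers of its maximal ideal are
compact, so that nested cosets of them have a common point. -/
theorem IsLocalRing.isAdicComplete_of_compactSpace (R : Type*) [CommRing R] [IsLocalRing R]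
    [IsNoetherianRing R] [TopologicalSpace R] [IsTopologicalRing R] [CompactSpace R] [T2Space R] :
    IsAdicComplete (IsLocalRing.maximalIdeal R) R := by
  have hH : IsHausdorff (IsLocalRing.maximalIdeal R) R := inferInstance
  refine { hH with prec' := fun f hf => ?_ }
  simp only [smul_eq_mul, Ideal.mul_top, SModEq.sub_mem] at hf ⊢
  have hV : ∀ n, IsCompact {x : R | f n - x ∈ IsLocalRing.maximalIdeal R ^ n} := fun n => by
    have h1 : {x : R | f n - x ∈ IsLocalRing.maximalIdeal R ^ n} =
        (fun y => f n - y) '' (IsLocalRing.maximalIdeal R ^ n : Ideal R) := by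
      ext x
      refine ⟨fun hx => ⟨f n - x, hx, sub_sub_cancel _ _⟩, ?_⟩
      rintro ⟨y, hy, rfl⟩
      simpa using hy
    rw [h1]
    exact (Ideal.isCompact_of_fg (IsNoetherian.noetherian _)).image (by fun_prop)
  obtain ⟨L, hL⟩ := IsCompact.nonempty_iInter_of_sequence_nonempty_isCompact_isClosed
    (fun n => {x : R | f n - x ∈ IsLocalRing.maximalIdeal R ^ n})
    (fun n x hx => by
      have h1 := add_mem (hf n.le_succ) (Ideal.pow_le_pow_right n.le_succ hx)
      rwa [sub_add_sub_cancel] at h1)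
    (fun n => ⟨f n, by simp⟩) (hV 0) (fun n => (hV n).isClosed)
  exact ⟨L, fun n => Set.mem_iInter.1 hL n⟩

/-- Generators of the maximal ideal of `R`, together with `X`, generate that of `R⟦X⟧`, while the
dimension increases by at least one. -/
theorem PowerSeries.isRegularLocalRing (R : Type*) [CommRing R] [IsRegularLocalRing R] :
    IsRegularLocalRing (PowerSeries R) := by
  have : IsLocalRing (PowerSeries R) := inferInstanceAs (IsLocalRing (MvPowerSeries Unit R))
  refine IsRegularLocalRing.of_spanFinrank_maximalIdeal_le _ ?_
  let s : Set R := (IsLocalRing.maximalIdeal R).generators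
  have hfg : (IsLocalRing.maximalIdeal R).FG := IsNoetherian.noetherian _
  have hs : s.Finite := Submodule.FG.finite_generators hfg
  have hmax : IsLocalRing.maximalIdeal (PowerSeries R) =
      Ideal.span (insert PowerSeries.X (PowerSeries.C '' s)) := by
    refine le_antisymm (fun φ hφ => ?_) (Ideal.span_le.2 ?_)
    · have h0 : PowerSeries.constantCoeff φ ∈ IsLocalRing.maximalIdeal R := by
        rw [IsLocalRing.mem_maximalIdeal, mem_nonunits_iff] at hφ ⊢
        exact fun hu => hφ (MvPowerSeries.isUnit_iff_constantCoeff.2 hu)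
      rw [← Submodule.span_generators (IsLocalRing.maximalIdeal R)] at h0
      rw [PowerSeries.eq_X_mul_shift_add_const φ]
      refine add_mem (Ideal.mul_mem_right _ _ (Ideal.subset_span (Set.mem_insert _ _))) ?_
      have h1 := Ideal.mem_map_of_mem PowerSeries.C h0
      change _ ∈ Ideal.map PowerSeries.C (Ideal.span s) at h1
      rw [Ideal.map_span] at h1
      exact Ideal.span_mono (Set.subset_insert _ _) h1
    · have hmem : ∀ φ : PowerSeries R, PowerSeries.constantCoeff φ ∈ IsLocalRing.maximalIdeal R →
          φ ∈ IsLocalRing.maximalIdeal (PowerSeries R) := fun φ hφ => by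
        rw [IsLocalRing.mem_maximalIdeal, mem_nonunits_iff] at hφ ⊢
        exact fun hu => hφ (hu.map PowerSeries.constantCoeff)
      rintro φ (rfl | ⟨c, hc, rfl⟩)
      · exact hmem _ (by simp)
      · refine hmem _ ?_
        rw [PowerSeries.constantCoeff_C, ← Submodule.span_generators (IsLocalRing.maximalIdeal R)]
        exact Submodule.subset_span hc
  have hle : (IsLocalRing.maximalIdeal (PowerSeries R)).spanFinrank ≤
      (IsLocalRing.maximalIdeal R).spanFinrank + 1 := by
    rw [hmax]
    refine (Submodule.spanFinrank_span_le_ncard_of_finite ((hs.image _).insert _)).trans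
      ((Set.ncard_insert_le _ _).trans (Nat.add_le_add_right ?_ 1))
    rw [← Submodule.FG.generators_ncard hfg]
    exact Set.ncard_image_le hs
  calc ((IsLocalRing.maximalIdeal (PowerSeries R)).spanFinrank : WithBot ℕ∞)
      ≤ ((IsLocalRing.maximalIdeal R).spanFinrank + 1 : ℕ) := by exact_mod_cast hle
    _ = ringKrullDim R + 1 := by
        rw [Nat.cast_add, (isRegularLocalRing_iff R).1 inferInstance, Nat.cast_one]
    _ ≤ _ := ringKrullDim_succ_le_ringKrullDim_powerseries

theorem MvPowerSeries.isRegularLocalRing (R : Type*) [CommRing R] [IsRegularLocalRing R] (n : ℕ) :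
    IsRegularLocalRing (MvPowerSeries (Fin n) R) := by
  induction n with
  | zero => exact IsRegularLocalRing.of_ringEquiv (isEmptyEquiv (Fin 0) R).symm.toRingEquiv
  | succ n ih =>
    have := PowerSeries.isRegularLocalRing (MvPowerSeries (Fin n) R)
    exact IsRegularLocalRing.of_ringEquiv (finSuccEquiv R n).symm.toRingEquiv

theorem MvPowerSeries.prime_X_fin {R : Type*} [CommRing R] [IsDomain R] {n : ℕ} (i : Fin (n + 1)) :
    Prime (X i : MvPowerSeries (Fin (n + 1)) R) := by
  have : IsDomain (MvPowerSeries (Fin n) R) := NoZeroDivisors.to_isDomain _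
  have h0 : Prime (X 0 : MvPowerSeries (Fin (n + 1)) R) := by
    rw [← MulEquiv.prime_iff (finSuccEquiv R n), finSuccEquiv_X_zero]
    exact PowerSeries.X_prime
  rw [← MulEquiv.prime_iff (renameEquiv R (Equiv.swap i 0))] at h0
  simpa using h0

theorem MvPowerSeries.not_X_dvd_X {σ R : Type*} [CommRing R] [Nontrivial R] {i j : σ} (h : i ≠ j) :
    ¬ (X i : MvPowerSeries σ R) ∣ X j := fun hd => by
  classical
  have := X_dvd_iff.1 hd (Finsupp.single j 1) (Finsupp.single_eq_of_ne h)
  rw [coeff_index_single_self_X] at this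
  exact one_ne_zero this

theorem MvPowerSeries.isUnit_C_mul_one_add_X_sub_one {σ R : Type*} [CommRing R] {u : R} (i : σ)
    (hu : IsUnit (u - 1)) : IsUnit (C u * (1 + X i) - 1 : MvPowerSeries σ R) :=
  isUnit_iff_constantCoeff.2 (by simpa using hu)

theorem MvPowerSeries.C_mul_one_add_X_sub_one_ne_zero {σ R : Type*} [CommRing R] {u : R} (i : σ)
    (hu : u ≠ 0) : (C u * (1 + X i) - 1 : MvPowerSeries σ R) ≠ 0 := fun h0 => by
  classical
  have h1 := congrArg (coeff (Finsupp.single i 1)) h0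
  have h2 : coeff (Finsupp.single i 1) (1 : MvPowerSeries σ R) = 0 := by
    rw [coeff_one, if_neg (by simp)]
  rw [map_sub, coeff_C_mul, map_add, h2, coeff_index_single_self_X, map_zero] at h1
  exact hu (by simpa using h1)

namespace Zq

variable (r : ℕ)

instance : IsModuleTopology ℤ_[p] (Zq p r) := ⟨rfl⟩

variable {r}

theorem isRegularLocalRing_mvPowerSeries (h : IsPadicUnramifiedLocal p (Zq p r)) :
    IsRegularLocalRing (MvPowerSeries (Fin 2) (Zq p r)) := by
  have := h.isDomain
  have := h.isDiscreteValuationRing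
  exact MvPowerSeries.isRegularLocalRing _ 2

theorem isAdicComplete_mvPowerSeries (h : IsPadicUnramifiedLocal p (Zq p r))
    [IsRegularLocalRing (MvPowerSeries (Fin 2) (Zq p r))] :
    IsAdicComplete (IsLocalRing.maximalIdeal (MvPowerSeries (Fin 2) (Zq p r)))
      (MvPowerSeries (Fin 2) (Zq p r)) := by
  have := h.finite
  have := h.free
  have := PadicInt.finite_moduleTopology_isTopologicalRing p (Zq p r)
  have := PadicInt.finite_moduleTopology_compactSpace p (Zq p r)
  have := PadicInt.finite_moduleTopology_t2Space p (Zq p r)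
  have := MvPowerSeries.compactSpace (σ := Fin 2) (R := Zq p r)
  have := MvPowerSeries.WithPiTopology.instIsTopologicalRing (Fin 2) (Zq p r)
  exact IsLocalRing.isAdicComplete_of_compactSpace _

end Zq

/-! ### The refined decomposition -/

section Refinement

variable {n : ∀ p : Nat.Primes, Cyc p × Cyc p → ℕ}
  {r : ∀ (p : Nat.Primes) (f : Cyc p × Cyc p), Fin (n p f) → ℕ}
  (e : ∀ (p : Nat.Primes) (f : Cyc p × Cyc p),
    CycTensor f ≃ₐ[ℤ_[p]] ∀ k : Fin (n p f), Zq p (r p f k))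

/-- The homomorphism from `∏ CycTensor f⟦s₁, s₂⟧` induced by decompositions of the rings
`CycTensor f`. -/
noncomputable def CycProduct.refine : CycProduct →+*
    ∀ (p : Nat.Primes) (c : Σ f : Cyc p × Cyc p, Fin (n p f)),
      MvPowerSeries (Fin 2) (Zq p (r p c.1 c.2)) :=
  RingHom.pi fun p => RingHom.pi fun c =>
    (MvPowerSeries.map ((Pi.evalRingHom (fun k => Zq p (r p c.1 k)) c.2).comp
      (e p c.1 : _ →+* _))).comp
        ((Pi.evalRingHom (fun f : Cyc p × Cyc p => MvPowerSeries (Fin 2) (CycTensor f)) c.1).comp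
          (Pi.evalRingHom (fun q : Nat.Primes =>
            ∀ f : Cyc q × Cyc q, MvPowerSeries (Fin 2) (CycTensor f)) p))

theorem CycProduct.refine_apply (x : CycProduct) (p : Nat.Primes)
    (c : Σ f : Cyc p × Cyc p, Fin (n p f)) :
    CycProduct.refine e x p c = MvPowerSeries.map
      ((Pi.evalRingHom (fun k => Zq p (r p c.1 k)) c.2).comp (e p c.1 : _ →+* _)) (x p c.1) :=
  rfl

theorem CycProduct.coeff_refine (x : CycProduct) (p : Nat.Primes) (f : Cyc p × Cyc p)
    (k : Fin (n p f)) (d : Fin 2 →₀ ℕ) :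
    MvPowerSeries.coeff d (CycProduct.refine e x p ⟨f, k⟩) =
      e p f (MvPowerSeries.coeff d (x p f)) k := by
  rw [CycProduct.refine_apply, MvPowerSeries.coeff_map]
  rfl

theorem CycProduct.refine_bijective : Function.Bijective (CycProduct.refine e) := by
  constructor
  · intro x y hxy
    funext p f
    ext d
    refine (e p f).injective (funext fun k => ?_)
    rw [← CycProduct.coeff_refine, hxy, CycProduct.coeff_refine]
  · intro y
    let x : CycProduct := fun p f => (fun d => (e p f).symm fun k =>
      MvPowerSeries.coeff d (y p ⟨f, k⟩) : (Fin 2 →₀ ℕ) → CycTensor f)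
    refine ⟨x, ?_⟩
    funext p c
    obtain ⟨f, k⟩ := c
    ext d
    rw [CycProduct.coeff_refine]
    change e p f ((e p f).symm fun k => MvPowerSeries.coeff d (y p ⟨f, k⟩)) k = _
    rw [AlgEquiv.apply_symm_apply]

theorem CycProduct.continuous_refine
    (hfin : ∀ (p : Nat.Primes) (f : Cyc p × Cyc p) (k : Fin (n p f)),
       Module.Finite ℤ_[p] (Zq p (r p f k))) :
    Continuous (CycProduct.refine e) := by
  refine continuous_pi fun p => continuous_pi fun c => continuous_pi fun d => ?_
  obtain ⟨f, k⟩ := c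
  have := hfin p f k
  have := PadicInt.finite_moduleTopology_isTopologicalRing p (Zq p (r p f k))
  have h1 : Continuous fun z : CycTensor f => e p f z k :=
    IsModuleTopology.continuous_of_linearMap
      ((LinearMap.proj k).comp (e p f).toLinearMap : CycTensor f →ₗ[ℤ_[p]] Zq p (r p f k))
  have h2 : Continuous fun x : CycProduct => MvPowerSeries.coeff d (x p f) :=
    (MvPowerSeries.WithPiTopology.continuous_coeff (CycTensor f) d).comp
      ((continuous_apply f).comp (continuous_apply p))
  exact (h1.comp h2).congr fun x => (CycProduct.coeff_refine e x p f k d).symm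

theorem CycProduct.isHomeomorph_refine
    (he : ∀ (p : Nat.Primes) (f : Cyc p × Cyc p) (k : Fin (n p f)),
       IsPadicUnramifiedLocal p (Zq p (r p f k))) :
    IsHomeomorph (CycProduct.refine e) := by
  have h2 : ∀ (p : Nat.Primes) (f : Cyc p × Cyc p) (k : Fin (n p f)),
      T2Space (Zq p (r p f k)) := fun p f k =>
    have := (he p f k).finite
    have := (he p f k).free
    PadicInt.finite_moduleTopology_t2Space p (Zq p (r p f k))
  rw [isHomeomorph_iff_continuous_bijective]
  exact ⟨CycProduct.continuous_refine e fun p f k => (he p f k).finite,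
    CycProduct.refine_bijective e⟩

end Refinement

/-! ### Images of the generators in the coordinates -/

namespace CycTensor

variable {f : Cyc p × Cyc p} {O : Type*} [CommRing O] [Algebra ℤ_[p] O]

theorem adjoin_range_map_root {φ : CycTensor f →ₐ[ℤ_[p]] O} (hφ : Function.Surjective φ) :
    Algebra.adjoin ℤ_[p] (Set.range fun i => φ (root f i)) = ⊤ := by
  have h1 : (Set.range fun i => φ (root f i)) = φ '' Set.range (root f) := Set.range_comp φ _
  rw [h1, Algebra.adjoin_image, adjoin_range_root, Algebra.map_top, AlgHom.range_eq_top]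
  exact hφ

theorem isOfFinOrder_map_root (φ : CycTensor f →ₐ[ℤ_[p]] O) (i : Fin 2) :
    IsOfFinOrder (φ (root f i)) ∧ (orderOf (φ (root f i))).Coprime p := by
  obtain ⟨m, hm1, hmp, hm⟩ := exists_root_pow_eq_one f
  have h : φ (root f i) ^ m = 1 := by rw [← map_pow, hm, map_one]
  exact ⟨isOfFinOrder_iff_pow_eq_one.2 ⟨m, hm1, h⟩,
    hmp.coprime_dvd_left (orderOf_dvd_of_pow_eq_one h)⟩

/-- The images of the roots are roots of unity of order prime to `p`, hence equal to `1` if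
congruent to `1`. -/
theorem map_root_eq_one (h : IsPadicUnramifiedLocal p O) (φ : CycTensor f →ₐ[ℤ_[p]] O) {i : Fin 2}
    (hu : ¬ IsUnit (φ (root f i) - 1)) : φ (root f i) = 1 :=
  h.eq_one_of_pow_eq_one (isOfFinOrder_map_root φ i).2 (pow_orderOf_eq_one _)
    (h.not_isUnit_iff_dvd.1 hu)

end CycTensor

theorem Cyc.eq_X_sub_one {g : ℤ_[p][X]} (hg : g ∈ Cyc p) (h : g.eval 1 = 0) : g = X - 1 := by
  obtain ⟨hm, hi, -⟩ := hg
  have h1 : X - C (1 : ℤ_[p]) ∣ g := dvd_iff_isRoot.2 h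
  exact (eq_of_monic_of_associated (monic_X_sub_C 1) hm
    ((irreducible_X_sub_C 1).associated_of_dvd hi h1)).symm.trans (by rw [map_one])

theorem Cyc.X_sub_one_mem : (X - 1 : ℤ_[p][X]) ∈ Cyc p := by
  rw [← map_one C]
  exact ⟨monic_X_sub_C 1, irreducible_X_sub_C 1, 1, le_rfl, Nat.coprime_one_left p, by simp⟩

namespace CycTensor

/-- The pair `(x - 1, x - 1)`. -/
noncomputable def trivialPair (p : ℕ) [Fact p.Prime] : Cyc p × Cyc p :=
  ⟨⟨_, Cyc.X_sub_one_mem⟩, ⟨_, Cyc.X_sub_one_mem⟩⟩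

theorem coe_poly_trivialPair (i : Fin 2) : (poly (trivialPair p) i : ℤ_[p][X]) = X - 1 := by
  fin_cases i <;> rfl

theorem root_trivialPair (i : Fin 2) : root (trivialPair p) i = 1 := by
  have := aeval_root (trivialPair p) i
  rw [coe_poly_trivialPair] at this
  simpa [sub_eq_zero] using this

theorem algebraMap_trivialPair_surjective :
    Function.Surjective (algebraMap ℤ_[p] (CycTensor (trivialPair p))) := by
  have h := adjoin_range_root (trivialPair p)
  have h1 : Algebra.adjoin ℤ_[p] (Set.range (root (trivialPair p))) ≤ ⊥ :=
    Algebra.adjoin_le (by rintro _ ⟨i, rfl⟩; rw [root_trivialPair]; exact one_mem _)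
  intro x
  exact Algebra.mem_bot.1 (h1 (h ▸ Algebra.mem_top))

theorem nontrivial_trivialPair : Nontrivial (CycTensor (trivialPair p)) := by
  obtain ⟨h, -⟩ := exists_lift (trivialPair p) (F := ℤ_[p]) (fun _ => 1) fun j => by
    rw [coe_poly_trivialPair]; simp
  exact h.toRingHom.domain_nontrivial

theorem eq_trivialPair {f : Cyc p × Cyc p} {O : Type*} [CommRing O] [Algebra ℤ_[p] O]
    (h : IsPadicUnramifiedLocal p O) (φ : CycTensor f →ₐ[ℤ_[p]] O)
    (hφ : ∀ i, φ (root f i) = 1) : f = trivialPair p := by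
  have := h.nontrivial
  have := h.torsionFree
  have := h.isDomain
  have h1 : ∀ i, (poly f i : ℤ_[p][X]) = X - 1 := fun i => by
    refine Cyc.eq_X_sub_one (poly f i).2 (FaithfulSMul.algebraMap_injective ℤ_[p] O ?_)
    have := congrArg φ (aeval_root f i)
    rw [← aeval_algHom_apply, hφ, map_zero] at this
    rw [map_zero, ← this, ← map_one (algebraMap ℤ_[p] O), aeval_algebraMap_apply, coe_aeval_eq_eval]
  exact Prod.ext (Subtype.ext (h1 0)) (Subtype.ext (h1 1))

/-- The ring belonging to the pair `(x - 1, x - 1)` is a quotient of `ℤ_p`, so in a decomposition of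
it no element is `1` in one factor and `0` in another. -/
theorem exists_forall_index_eq_of_trivialPair {n : ℕ} {O : Fin n → Type*} [∀ k, CommRing (O k)]
    [∀ k, Algebra ℤ_[p] (O k)] (h : ∀ k, IsPadicUnramifiedLocal p (O k))
    (e : CycTensor (trivialPair p) ≃ₐ[ℤ_[p]] ∀ k, O k) : ∃ k : Fin n, ∀ l, l = k := by
  have := nontrivial_trivialPair (p := p)
  have hne : Nonempty (Fin n) := by
    by_contra hempty
    rw [not_nonempty_iff] at hempty
    exact one_ne_zero (e.injective (Subsingleton.elim (e 1) (e 0)))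
  obtain ⟨k⟩ := hne
  refine ⟨k, fun l => ?_⟩
  by_contra hlk
  obtain ⟨x, hx⟩ := e.surjective (Pi.single k 1)
  obtain ⟨z, rfl⟩ := algebraMap_trivialPair_surjective x
  rw [AlgEquiv.commutes] at hx
  have hl := congrFun hx l
  have hk := congrFun hx k
  rw [Pi.algebraMap_apply, Pi.single_eq_of_ne hlk] at hl
  rw [Pi.algebraMap_apply, Pi.single_eq_same] at hk
  have := (h l).nontrivial
  have := (h k).nontrivial
  have := (h l).torsionFree
  have := (h l).isDomain
  rw [(map_eq_zero_iff _ (FaithfulSMul.algebraMap_injective ℤ_[p] (O l))).1 hl, map_zero] at hk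
  exact zero_ne_one hk

end CycTensor

/-! ### Complete regular local coordinates -/

theorem mainTheorem7 {A : Type*} [CommGroup A] [TopologicalSpace A] [IsTopologicalGroup A]
    (hA : Nonempty (A ≃ₜ* Multiplicative (ZHat × ZHat)))
    (a : Fin 2 → A) (ha : (Subgroup.closure (Set.range a)).topologicalClosure = ⊤) :
    -- the product decomposition, as topological rings
    ∃ Φ : CompletedGroupAlgebra ZHat A ≃+*
        ∀ (p : Nat.Primes) (f : Cyc p × Cyc p), MvPowerSeries (Fin 2) (CycTensor f),
      IsHomeomorph Φ ∧
      (∀ p f i, Φ (CompletedGroupAlgebra.of ZHat (a i)) p f =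
        MvPowerSeries.C (CycTensor.root f i) * (1 + MvPowerSeries.X i)) ∧
      -- each coefficient ring is a finite product of rings `ℤ_q`; `Ψ` is the resulting refinement
      ∃ (n : ∀ p : Nat.Primes, Cyc p × Cyc p → ℕ)
        (r : ∀ (p : Nat.Primes) (f : Cyc p × Cyc p), Fin (n p f) → ℕ)
        (e : ∀ (p : Nat.Primes) (f : Cyc p × Cyc p),
          CycTensor f ≃ₐ[ℤ_[p]] ∀ k : Fin (n p f), Zq p (r p f k))
        (Ψ : CompletedGroupAlgebra ZHat A ≃+*
          ∀ (p : Nat.Primes) (c : Σ f : Cyc p × Cyc p, Fin (n p f)),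
            MvPowerSeries (Fin 2) (Zq p (r p c.1 c.2)))
        (u : ∀ (p : Nat.Primes) (c : Σ f : Cyc p × Cyc p, Fin (n p f)),
          Fin 2 → Zq p (r p c.1 c.2)),
        IsHomeomorph Ψ ∧
        (∀ x p c, Ψ x p c = MvPowerSeries.map
          ((Pi.evalRingHom (fun k => Zq p (r p c.1 k)) c.2).comp (e p c.1 : _ →+* _))
          (Φ x p c.1)) ∧
        (∀ p f k, 1 ≤ r p f k) ∧
        -- every factor is a complete regular local ring
        (∀ (p : Nat.Primes) (c : Σ f : Cyc p × Cyc p, Fin (n p f)),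
          ∃ _ : IsRegularLocalRing (MvPowerSeries (Fin 2) (Zq p (r p c.1 c.2))),
            IsAdicComplete
              (IsLocalRing.maximalIdeal (MvPowerSeries (Fin 2) (Zq p (r p c.1 c.2))))
              (MvPowerSeries (Fin 2) (Zq p (r p c.1 c.2)))) ∧
        -- the images of `a₁`, `a₂`
        (∀ (p : Nat.Primes) c i, Ψ (CompletedGroupAlgebra.of ZHat (a i)) p c =
          MvPowerSeries.C (u p c i) * (1 + MvPowerSeries.X i)) ∧
        (∀ (p : Nat.Primes) c i, IsOfFinOrder (u p c i) ∧ (orderOf (u p c i)).Coprime p) ∧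
        (∀ (p : Nat.Primes) c, Algebra.adjoin ℤ_[p] (Set.range (u p c)) = ⊤) ∧
        -- the images of `a₁ - 1`, `a₂ - 1` are nonzero and coprime
        (∀ (p : Nat.Primes) c i, Ψ (CompletedGroupAlgebra.of ZHat (a i) - 1) p c ≠ 0) ∧
        (∀ (p : Nat.Primes) c, ¬ ∃ π, Prime π ∧
          ∀ i, π ∣ Ψ (CompletedGroupAlgebra.of ZHat (a i) - 1) p c) ∧
        -- the distinguished factor for each `p`, and all other factors
        (∀ p : Nat.Primes, ∃ c₀ : Σ f : Cyc p × Cyc p, Fin (n p f),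
          (∀ c, (∀ i, Prime (Ψ (CompletedGroupAlgebra.of ZHat (a i) - 1) p c)) ↔ c = c₀) ∧
          (∀ i, Ψ (CompletedGroupAlgebra.of ZHat (a i) - 1) p c₀ = MvPowerSeries.X i) ∧
          (∀ c, c ≠ c₀ →
            ∃ i, IsUnit (Ψ (CompletedGroupAlgebra.of ZHat (a i) - 1) p c))) := by
  obtain ⟨Φ, hΦ, hΦa⟩ := exists_ringEquiv_cycProduct hA a ha
  choose n r e hrl using fun (p : Nat.Primes) (f : Cyc p × Cyc p) =>
    (CycTensor.isPadicUnramified f).exists_algEquiv_pi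
  have hloc : ∀ (p : Nat.Primes) (c : Σ f : Cyc p × Cyc p, Fin (n p f)),
      IsPadicUnramifiedLocal p (Zq p (r p c.1 c.2)) := fun p c => (hrl p c.1 c.2).2
  have hhom := CycProduct.isHomeomorph_refine e fun p f k => (hrl p f k).2
  let Ψ := Φ.trans (RingEquiv.ofBijective (CycProduct.refine e) hhom.bijective)
  let φ : ∀ (p : Nat.Primes) (c : Σ f : Cyc p × Cyc p, Fin (n p f)),
      CycTensor c.1 →ₐ[ℤ_[p]] Zq p (r p c.1 c.2) := fun p c =>
    (Pi.evalAlgHom ℤ_[p] (fun k => Zq p (r p c.1 k)) c.2).comp (e p c.1 : _ →ₐ[ℤ_[p]] _)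
  have hφ : ∀ p c, Function.Surjective (φ p c) := fun p c =>
    (Function.surjective_eval c.2).comp (e p c.1).surjective
  let u : ∀ (p : Nat.Primes) (c : Σ f : Cyc p × Cyc p, Fin (n p f)),
      Fin 2 → Zq p (r p c.1 c.2) := fun p c i => φ p c (CycTensor.root c.1 i)
  have hΨ : ∀ x p c, Ψ x p c = MvPowerSeries.map (φ p c : _ →+* _) (Φ x p c.1) :=
    fun x p c => rfl
  have hΨa : ∀ (p : Nat.Primes) (c : Σ f : Cyc p × Cyc p, Fin (n p f)) (i : Fin 2),
      Ψ (CompletedGroupAlgebra.of ZHat (a i)) p c =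
        MvPowerSeries.C (u p c i) * (1 + MvPowerSeries.X i) := fun p c i => by
    rw [hΨ, hΦa]
    change MvPowerSeries.map _ (MvPowerSeries.C _ * (1 + MvPowerSeries.X i)) = _
    rw [map_mul, map_add, map_one, MvPowerSeries.map_C, MvPowerSeries.map_X]
    rfl
  have hΨa' : ∀ (p : Nat.Primes) (c : Σ f : Cyc p × Cyc p, Fin (n p f)) (i : Fin 2),
      Ψ (CompletedGroupAlgebra.of ZHat (a i) - 1) p c =
        MvPowerSeries.C (u p c i) * (1 + MvPowerSeries.X i) - 1 := fun p c i => by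
    rw [map_sub, map_one, ← hΨa]
    rfl
  -- the constant term of the image of `a i - 1` is `u i - 1`
  have hu1 : ∀ (p : Nat.Primes) (c : Σ f : Cyc p × Cyc p, Fin (n p f)) (i : Fin 2),
      ¬ IsUnit (Ψ (CompletedGroupAlgebra.of ZHat (a i) - 1) p c) → u p c i = 1 :=
    fun p c i hnu => CycTensor.map_root_eq_one (hloc p c) (φ p c) fun hu => hnu (by
      rw [hΨa']
      exact MvPowerSeries.isUnit_C_mul_one_add_X_sub_one i hu)
  have hX : ∀ (p : Nat.Primes) (c : Σ f : Cyc p × Cyc p, Fin (n p f)) (i : Fin 2),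
      u p c i = 1 → Ψ (CompletedGroupAlgebra.of ZHat (a i) - 1) p c = MvPowerSeries.X i :=
    fun p c i hu => by rw [hΨa', hu, map_one, one_mul, add_sub_cancel_left]
  refine ⟨Φ, hΦ, fun p f i => by rw [hΦa]; rfl, n, r, e, Ψ, u, hhom.comp hΦ, fun x p c => rfl,
    fun p f k => (hrl p f k).1, fun p c => ?_, hΨa,
    fun p c i => CycTensor.isOfFinOrder_map_root (φ p c) i,
    fun p c => CycTensor.adjoin_range_map_root (hφ p c), fun p c i => ?_, fun p c => ?_,
    fun p => ?_⟩
  · have h := Zq.isRegularLocalRing_mvPowerSeries (hloc p c)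
    exact ⟨h, Zq.isAdicComplete_mvPowerSeries (hloc p c)⟩
  · have := (hloc p c).nontrivial
    rw [hΨa']
    exact MvPowerSeries.C_mul_one_add_X_sub_one_ne_zero i
      ((CycTensor.isUnit_root c.1 i).map (φ p c)).ne_zero
  · rintro ⟨π, hπ, hdvd⟩
    have := (hloc p c).isDomain
    have h1 : ∀ i, Ψ (CompletedGroupAlgebra.of ZHat (a i) - 1) p c = MvPowerSeries.X i := fun i =>
      hX p c i (hu1 p c i fun hu => hπ.not_isUnit (isUnit_of_dvd_unit (hdvd i) hu))
    have h0 := hdvd 0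
    rw [h1] at h0
    have h2 := hdvd 1
    rw [h1] at h2
    have hass := hπ.irreducible.associated_of_dvd
      (MvPowerSeries.prime_X_fin (R := Zq p (r p c.1 c.2)) (n := 1) 0).irreducible h0
    exact MvPowerSeries.not_X_dvd_X zero_ne_one (hass.dvd_iff_dvd_left.1 h2)
  · obtain ⟨k, hk⟩ := CycTensor.exists_forall_index_eq_of_trivialPair
      (fun k => (hrl p (CycTensor.trivialPair p) k).2) (e p (CycTensor.trivialPair p))
    -- the coordinate in which both `u i` are `1`
    have hc : ∀ c : Σ f : Cyc p × Cyc p, Fin (n p f), (∀ i, u p c i = 1) →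
        c = ⟨CycTensor.trivialPair p, k⟩ := by
      intro c hc
      have hf := CycTensor.eq_trivialPair (hloc p c) (φ p c) hc
      obtain ⟨f, l⟩ := c
      obtain rfl : f = CycTensor.trivialPair p := hf
      rw [hk l]
    have hc₀ : ∀ i, Ψ (CompletedGroupAlgebra.of ZHat (a i) - 1) p
        ⟨CycTensor.trivialPair p, k⟩ = MvPowerSeries.X i := fun i =>
      hX p _ i (by
        change φ p ⟨CycTensor.trivialPair p, k⟩ (CycTensor.root (CycTensor.trivialPair p) i) = 1
        rw [CycTensor.root_trivialPair, map_one])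
    refine ⟨⟨CycTensor.trivialPair p, k⟩, fun c => ⟨fun hprime => hc c fun i =>
      hu1 p c i (hprime i).not_isUnit, ?_⟩, hc₀, fun c hne => ?_⟩
    · rintro rfl i
      have := (hloc p ⟨CycTensor.trivialPair p, k⟩).isDomain
      rw [hc₀]
      exact MvPowerSeries.prime_X_fin (n := 1) i
    · by_contra! hnu
      exact hne (hc c fun i => hu1 p c i (hnu i))
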